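/- **Setting.** Let $d\ge 1$ and let $A$ be a real $d\times d$ matrix that is expanding (all its complex eigenvalues have modulus $>1$); put $q=|\det A|$. Let $(\mathcal A,\Gamma)$ be a finite directed multigraph with vertex set $\mathcal A$ and edge set $\Gamma$, let $\Gamma_{ij}$ be the set of edges from $i$ to $j$, and $\Gamma_i$ the set of edges leaving $i$. For each $e\in\Gamma$ let $g_e(x)=A^{-1}(x+d_e)$ with $d_e\in\mathbb R^d$, and let $\mathcal G=\{g_e\}_{e\in\Gamma}$ (a *single-matrix graph-directed IFS*). Its *invariant sets* $(E_i)_{i\in\mathcal A}$ are the nonempty compact sets with $E_i=\bigcup_{j}\bigcup_{e\in\Gamma_{ij}}g_e(E_j)$ for all $i$. Let $\prec$ be a strict partial order on $\Gamma$ that is linear on each $\Gamma_i$ and for which edges leaving different vertices are never comparable; it induces a lexicographic (linear) order on the set $\Gamma_i^k$ of walks of length $k$ starting at $i$. For a walk $\gamma=\gamma_1\cdots\gamma_k$ ending at the vertex $t(\gamma)$, let $E_\gamma=g_{\gamma_1}\circ\cdots\circ g_{\gamma_k}(E_{t(\gamma)})$. The system $(\mathcal A,\Gamma,\mathcal G,\prec)$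 is *linear* if $E_\gamma\cap E_\eta\neq\emptyset$ for all $i\in\mathcal A$, $k\ge1$ and all $\gamma,\eta\in\Gamma_i^k$ that are adjacent (consecutive) in this order. It satisfies the *open set condition* if there are nonempty open sets $U_i\subset\mathbb R^d$ $(i\in\mathcal A)$ such that for every $i$ the sets $g_e(U_j)$ ($j\in\mathcal A$, $e\in\Gamma_{ij}$) are pairwise disjoint and contained in $U_i$. The *associated matrix* is $M=(m_{ij})$, $m_{ij}=\#\Gamma_{ji}$; it is *primitive* if $M^n$ has only positive entries for some $n\ge1$. Let $\delta\in(0,\tfrac12)$ and let $\varphi:\mathbb R^d\to[0,\infty)$ be a $C^\infty$ function that vanishes outside $B(0,\delta)$, with $\varphi(0)>0$, $\varphi(-x)=\varphi(x)$ and $\int\varphi=1$. Let $V=A(B(0,1))\setminus B(0,1)$, where $B(0,r)$ denotes the open Euclidean ball, let $h=\chi_V*\varphi$, and define the pseudo-norm $$\|x\|_\omega=\sum_{n\in\mathbb Z}q^{-n/d}\,h(A^nx).$$ Let $\operatorname{diam}_\omega S=\sup_{x,y\in S}\|x-y\|_\omega$, and for $s\ge0$ let $$\mathcal H_\omega^s(S)=\lim_{\varepsilon\to0}\inf\Big\{\sum_i(\operatorname{diam}_\omega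 T_i)^s:\ S\subset\bigcup_iT_i,\ \operatorname{diam}_\omega T_i\le\varepsilon\Big\}$$ (countable covers), and $\dim_\omega S=\inf\{s\ge0:\mathcal H^s_\omega(S)=0\}$. **Theorem 1.1.** Let $(\mathcal A,\Gamma,\mathcal G,\prec)$ be a linear single-matrix graph-directed IFS with expanding matrix $A$ which satisfies the open set condition, whose associated matrix $M$ is primitive, and which has more than one edge. Let $j\in\mathcal A$ and $\alpha=\dim_\omega E_j$. Then $\alpha>0$, and there is a continuous surjective map $\psi_j:[0,1]\to E_j$ such that (i) $\psi_j$ is a measure isomorphism between $([0,1],\mathcal B([0,1]),\mathcal L)$ and $(E_j,\mathcal B(E_j),\mathcal H^\alpha_\omega)$; that is, $c_j:=\mathcal H^\alpha_\omega(E_j)\in(0,\infty)$, there are Borel sets $I'\subset[0,1]$ and $E'\subset E_j$ of full measure such that $\psi_j:I'\to E'$ is a bijection, and $$\mathcal H^\alpha_\omega(\psi_j(F))=c_j\,\mathcal L(F),\qquad \mathcal L(\psi_j^{-1}(B))=c_j^{-1}\,\mathcal H_\omega^\alpha(B)$$ for all Borel sets $F\subset[0,1]$ and $B\subset E_j$;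 (ii) there is a constant $c>0$ with $\|\psi_j(x)-\psi_j(y)\|_\omega\le c\,|x-y|^{1/\alpha}$ for all $x,y\in[0,1]$. -/

import Mathlib

open Set MeasureTheory
open scoped ENNReal ContDiff

noncomputable section

namespace LinearGIFS

/-- A real square matrix is expanding if all its complex eigenvalues have modulus `> 1`. -/
def IsExpanding {d : ℕ} (A : Matrix (Fin d) (Fin d) ℝ) : Prop :=
  ∀ z ∈ spectrum ℂ (A.map (fun a : ℝ => (a : ℂ))), 1 < ‖z‖

/-! ### The pseudo-norm, its Hausdorff measure and Hausdorff dimension -/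

section PseudoNorm

variable {d : ℕ}

/-- The admissible smoothing kernels `φ_δ`: smooth, nonnegative (and nonvanishing at the centre),
supported in the ball `B(0, δ)`, even, of total integral one. -/
structure IsKernel (δ : ℝ) (φ : EuclideanSpace ℝ (Fin d) → ℝ) : Prop where
  smooth : ContDiff ℝ ∞ φ
  nonneg : ∀ x, 0 ≤ φ x
  pos_zero : 0 < φ 0
  support_subset : Function.support φ ⊆ Metric.ball 0 δ
  even : ∀ x, φ (-x) = φ x
  integral_eq_one : ∫ x, φ x = 1

/-- `V = A (B(0,1)) \ B(0,1)`. -/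
def annulus (A : Matrix (Fin d) (Fin d) ℝ) : Set (EuclideanSpace ℝ (Fin d)) :=
  (A.toEuclideanLin '' Metric.ball 0 1) \ Metric.ball 0 1

/-- `h = χ_V * φ`, the smoothed indicator function of `V`. -/
def smoothedIndicator (A : Matrix (Fin d) (Fin d) ℝ) (φ : EuclideanSpace ℝ (Fin d) → ℝ)
    (x : EuclideanSpace ℝ (Fin d)) : ℝ :=
  ∫ y, (annulus A).indicator (fun _ => (1 : ℝ)) (x - y) * φ y

/-- `‖x‖_ω = ∑_{n ∈ ℤ} q^{-n/d} h(Aⁿ x)` with `q = |det A|`.  For an expanding `A` and a kernel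
`φ` supported in `B(0, δ)`, `δ < 1/2`, only finitely many terms are nonzero, for each `x`. -/
def pseudoNorm (A : Matrix (Fin d) (Fin d) ℝ) (φ : EuclideanSpace ℝ (Fin d) → ℝ)
    (x : EuclideanSpace ℝ (Fin d)) : ℝ :=
  ∑' n : ℤ, |A.det| ^ (-(n : ℝ) / (d : ℝ)) * smoothedIndicator A φ ((A ^ n).toEuclideanLin x)

/-- The diameter `sup {‖x - y‖_ω ; x, y ∈ S}`, as an extended nonnegative real. -/
def omegaDiam (A : Matrix (Fin d) (Fin d) ℝ) (φ : EuclideanSpace ℝ (Fin d) → ℝ)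
    (S : Set (EuclideanSpace ℝ (Fin d))) : ℝ≥0∞ :=
  ⨆ x ∈ S, ⨆ y ∈ S, ENNReal.ofReal (pseudoNorm A φ (x - y))

/-- `H_{ω,ε}^s(S)`: the infimum of `∑ (diam_ω T_i)^s` over countable covers of `S` by sets of
`ω`-diameter at most `ε`.  Empty sets of the cover contribute `0` (which matters for `s = 0`
only). -/
def omegaHausdorffPre (A : Matrix (Fin d) (Fin d) ℝ) (φ : EuclideanSpace ℝ (Fin d) → ℝ)
    (s : ℝ) (ε : ℝ≥0∞) (S : Set (EuclideanSpace ℝ (Fin d))) : ℝ≥0∞ :=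
  ⨅ (T : ℕ → Set (EuclideanSpace ℝ (Fin d))) (_ : S ⊆ ⋃ i, T i)
    (_ : ∀ i, omegaDiam A φ (T i) ≤ ε), ∑' i, ⨆ _ : (T i).Nonempty, omegaDiam A φ (T i) ^ s

/-- The `s`-dimensional Hausdorff (outer) measure with respect to `‖·‖_ω`.  The limit as `ε → 0`
is a supremum, because the approximations increase as `ε` decreases. -/
def omegaHausdorff (A : Matrix (Fin d) (Fin d) ℝ) (φ : EuclideanSpace ℝ (Fin d) → ℝ)
    (s : ℝ) (S : Set (EuclideanSpace ℝ (Fin d))) : ℝ≥0∞ :=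
  ⨆ (ε : ℝ≥0∞) (_ : 0 < ε), omegaHausdorffPre A φ s ε S

/-- The Hausdorff dimension `inf {s ≥ 0 ; H_ω^s(S) = 0}` with respect to `‖·‖_ω`. -/
def omegaDim (A : Matrix (Fin d) (Fin d) ℝ) (φ : EuclideanSpace ℝ (Fin d) → ℝ)
    (S : Set (EuclideanSpace ℝ (Fin d))) : ℝ :=
  sInf {s : ℝ | 0 ≤ s ∧ omegaHausdorff A φ s S = 0}

end PseudoNorm

/-! ### Ordered single-matrix graph-directed iterated function systems -/

/-- An ordered single-matrix graph-directed IFS `(V, Γ, 𝒢, ≺)` on `ℝᵈ`: a directed multigraph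
with vertex set `V` and edge set `Γ`, an expanding matrix `A`, a vector `digit e` for every edge
(the maps are `g_e x = A⁻¹ (x + digit e)`), and a strict partial order `≺` on `Γ` which is linear
on the edges leaving a given vertex and relates no edges leaving different vertices. -/
structure OrderedGIFS (d : ℕ) (V Γ : Type*) where
  /-- initial vertex of an edge -/
  src : Γ → V
  /-- terminal vertex of an edge -/
  tgt : Γ → V
  A : Matrix (Fin d) (Fin d) ℝ
  expanding : IsExpanding A
  digit : Γ → EuclideanSpace ℝ (Fin d)
  prec : Γ → Γ → Prop
  prec_irrefl : ∀ e, ¬ prec e e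
  prec_trans : ∀ e f g, prec e f → prec f g → prec e g
  prec_total : ∀ e f, src e = src f → prec e f ∨ e = f ∨ prec f e
  prec_src : ∀ e f, prec e f → src e = src f

namespace OrderedGIFS

variable {d : ℕ} {V Γ : Type*} (G : OrderedGIFS d V Γ)

/-- `g_e x = A⁻¹ (x + d_e)`. -/
def map (e : Γ) (x : EuclideanSpace ℝ (Fin d)) : EuclideanSpace ℝ (Fin d) :=
  (G.A⁻¹).toEuclideanLin (x + G.digit e)

/-- The associated matrix: `M i j` is the number of edges from `j` to `i`. -/
def assocMatrix : Matrix V V ℝ :=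
  fun i j => (Nat.card {e : Γ // G.src e = j ∧ G.tgt e = i} : ℝ)

/-- `E` is the family of invariant sets: nonempty compact sets with
`E_i = ⋃_j ⋃_{e : i → j} g_e (E_j)`. -/
structure IsInvariantFamily (E : V → Set (EuclideanSpace ℝ (Fin d))) : Prop where
  nonempty : ∀ i, (E i).Nonempty
  isCompact : ∀ i, IsCompact (E i)
  eq_iUnion : ∀ i, E i = ⋃ (e : Γ) (_ : G.src e = i), G.map e '' E (G.tgt e)

/-- The open set condition. -/
def OpenSetCondition : Prop :=
  ∃ U : V → Set (EuclideanSpace ℝ (Fin d)),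
    (∀ i, IsOpen (U i) ∧ (U i).Nonempty) ∧
    (∀ e : Γ, G.map e '' U (G.tgt e) ⊆ U (G.src e)) ∧
    (∀ e f : Γ, e ≠ f → G.src e = G.src f →
      Disjoint (G.map e '' U (G.tgt e)) (G.map f '' U (G.tgt f)))

/-- `γ` is a finite walk (a list of consecutive edges) starting at the vertex `i`. -/
def IsWalkFrom : V → List Γ → Prop
  | _, [] => True
  | i, e :: γ => G.src e = i ∧ IsWalkFrom (G.tgt e) γ

/-- The terminal vertex of a walk starting at `i`. -/
def terminal : V → List Γ → V
  | i, [] => i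
  | _, e :: γ => terminal (G.tgt e) γ

/-- `g_γ = g_{γ₁} ∘ ⋯ ∘ g_{γₙ}`. -/
def walkMap : List Γ → EuclideanSpace ℝ (Fin d) → EuclideanSpace ℝ (Fin d)
  | [] => id
  | e :: γ => G.map e ∘ walkMap γ

/-- The cylinder `E_γ = g_γ (E_{t(γ)})` of a walk `γ` starting at `i`. -/
def cylinder (E : V → Set (EuclideanSpace ℝ (Fin d))) (i : V) (γ : List Γ) :
    Set (EuclideanSpace ℝ (Fin d)) :=
  G.walkMap γ '' E (G.terminal i γ)

/-- The set `Γ_i^k` of walks of length `k` starting at `i`. -/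
def walks (i : V) (k : ℕ) : Set (List Γ) :=
  {γ | G.IsWalkFrom i γ ∧ γ.length = k}

/-- `γ` and `η` are consecutive elements of `Γ_i^k` in the lexicographic order (`γ` the lower). -/
def Adjacent (i : V) (k : ℕ) (γ η : List Γ) : Prop :=
  γ ∈ G.walks i k ∧ η ∈ G.walks i k ∧ List.Lex G.prec γ η ∧
    ¬ ∃ θ ∈ G.walks i k, List.Lex G.prec γ θ ∧ List.Lex G.prec θ η

/-- The ordered GIFS with invariant sets `E` is linear: the cylinders of any two adjacent walks
intersect. -/
def IsLinear (E : V → Set (EuclideanSpace ℝ (Fin d))) : Prop :=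
  ∀ (i : V) (k : ℕ), 1 ≤ k → ∀ γ η : List Γ, G.Adjacent i k γ η →
    (G.cylinder E i γ ∩ G.cylinder E i η).Nonempty

end OrderedGIFS

/-! ### Parametrizations and measure isomorphisms -/

/-- `ψ : [0,1] → S` is a parametrization of `S`: continuous and onto. -/
def IsParametrization {d : ℕ} (ψ : ℝ → EuclideanSpace ℝ (Fin d))
    (S : Set (EuclideanSpace ℝ (Fin d))) : Prop :=
  ContinuousOn ψ (Icc 0 1) ∧ ψ '' Icc 0 1 = S

/-- `ψ` is a measure isomorphism between `[0,1]` with Lebesgue measure and `S` with the measure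
`H`: the total mass `c = H(S)` is positive and finite, `ψ` is a bijection between Borel sets of
full measure, and it transports the measures into each other, up to the factor `c`. -/
structure IsMeasureIso {d : ℕ} (H : Set (EuclideanSpace ℝ (Fin d)) → ℝ≥0∞)
    (ψ : ℝ → EuclideanSpace ℝ (Fin d)) (S : Set (EuclideanSpace ℝ (Fin d))) : Prop where
  mass_pos : 0 < H S
  mass_lt_top : H S < ⊤
  exists_bijOn : ∃ (I' : Set ℝ) (S' : Set (EuclideanSpace ℝ (Fin d))),
    I' ⊆ Icc 0 1 ∧ S' ⊆ S ∧ MeasurableSet I' ∧ MeasurableSet S' ∧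
      volume (Icc 0 1 \ I') = 0 ∧ H (S \ S') = 0 ∧ BijOn ψ I' S'
  measure_image : ∀ F : Set ℝ, F ⊆ Icc 0 1 → MeasurableSet F → H (ψ '' F) = H S * volume F
  measure_preimage : ∀ B : Set (EuclideanSpace ℝ (Fin d)), B ⊆ S → MeasurableSet B →
    volume (Icc 0 1 ∩ ψ ⁻¹' B) = (H S)⁻¹ * H B

end LinearGIFS

end

open Filter Topology

namespace LinearGIFS

/-! ### Expanding matrices: decay of the powers of the inverse. -/

section Expanding

/-! Measured by the pseudo-norm, `A⁻¹` contracts by exactly `ratio A`, so the affine system behaves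
like a self-similar one. Let `v > 0` be the Perron eigenvector of the transpose of `M`, let `ρ < 1`
be the inverse of its eigenvalue, and let `s` solve `ratio A ^ s = ρ`. The weights `ρ v(t(e)) /
v(s(e))` of the edges leaving a vertex add up to one. Laid out along `≺`, they subdivide `[0,1]`
again and again, and a walk of length `k` receives an interval of length comparable to `ρ ^ k`. The
map `ψ` sends `x` to a point common to the cylinders of all walks whose intervals `x` selects.

If two points are closer than every interval of level `k`, their walks are equal or adjacent. By
linearity the cylinders meet, and the images are `O(ratio A ^ k)` apart; this is the Hölder bound
(`exists_holder_bound`), and it makes `H^s(E_i)` finite. By the open set condition, a set of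
diameter `ratio A ^ k` meets boundedly many cylinders of level `k` (`exists_card_cylinders_le`). The
image of Lebesgue measure is therefore at most `C diam^s`, and the mass distribution principle gives
`H^s(E_j) > 0`. Hence `α = s`.

For the measure isomorphism, `h_i = H^s(E_i)` satisfies `h_i ≤ ∑ ρ h_{t(e)}` by subadditivity.
Perron rigidity makes `h` a multiple of `v`, so the measure of a cylinder is at most its weight
times `h_i` (`omegaHausdorff_cylinder_le`). Covering compact sets by small cylinders yields `H^s ≤
h_i ν` on `E_i`, where `ν` is the image of Lebesgue measure; equal total mass forces equality
(`omegaHausdorff_eq_mul_volume_preimage`). The preimage of a cylinder then differs from its interval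
by a null set only, so `ψ` is injective off a null set (`exists_injOn_coding`). -/

theorem tendsto_pow_zero_of_spectralRadius_lt_one {R : Type*} [NormedRing R] [NormedAlgebra ℂ R]
    [CompleteSpace R] (a : R) (h : spectralRadius ℂ a < 1) :
    Tendsto (fun k : ℕ => a ^ k) atTop (𝓝 0) := by
  obtain ⟨r, hr, hr1⟩ := ENNReal.lt_iff_exists_nnreal_btwn.1 h
  have hr1' : r < 1 := by exact_mod_cast hr1
  -- Gelfand's formula: eventually `‖a ^ n‖ ^ (1 / n) < r`.
  have hev := (spectrum.pow_nnnorm_pow_one_div_tendsto_nhds_spectralRadius a).eventually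
    (gt_mem_nhds hr)
  refine squeeze_zero_norm' ?_ (tendsto_pow_atTop_nhds_zero_of_lt_one r.coe_nonneg
    (by exact_mod_cast hr1' : (r : ℝ) < 1))
  filter_upwards [hev, eventually_gt_atTop 0] with n hn hn0
  have hn0' : (n : ℝ) ≠ 0 := by exact_mod_cast hn0.ne'
  have := ENNReal.rpow_lt_rpow hn (by exact_mod_cast hn0 : (0 : ℝ) < n)
  rw [← ENNReal.rpow_mul, one_div, inv_mul_cancel₀ hn0', ENNReal.rpow_one,
    ENNReal.rpow_natCast] at this
  have h2 : ‖a ^ n‖₊ < r ^ n := by exact_mod_cast this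
  exact le_of_lt (by exact_mod_cast h2)

variable {d : ℕ} {A : Matrix (Fin d) (Fin d) ℝ}

theorem IsExpanding.isUnit_map (hA : IsExpanding A) :
    IsUnit (A.map (fun a : ℝ => (a : ℂ))) := by
  by_contra h
  have := hA 0 (spectrum.zero_mem_iff ℂ |>.2 h)
  norm_num at this

theorem map_ofReal_eq (A : Matrix (Fin d) (Fin d) ℝ) :
    A.map (fun a : ℝ => (a : ℂ)) = Complex.ofRealHom.mapMatrix A := rfl

theorem IsExpanding.isUnit_det (hA : IsExpanding A) : IsUnit A.det := by
  have h := (Matrix.isUnit_iff_isUnit_det _).1 hA.isUnit_map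
  rw [map_ofReal_eq, ← RingHom.map_det] at h
  rw [isUnit_iff_ne_zero] at h ⊢
  intro h0
  exact h (by simp [h0])

/-- The complex eigenvalues of `A⁻¹` are the inverses of those of `A`, so its spectral radius is
below one. Convergence is proved over `ℂ` and read off from the real parts of the entries. -/
theorem IsExpanding.tendsto_inv_pow (hd : 0 < d) (hA : IsExpanding A) :
    Tendsto (fun k : ℕ => (A⁻¹) ^ k) atTop (𝓝 0) := by
  have : Nonempty (Fin d) := ⟨⟨0, hd⟩⟩
  let : NormedRing (Matrix (Fin d) (Fin d) ℂ) := Matrix.linftyOpNormedRing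
  let : NormedAlgebra ℂ (Matrix (Fin d) (Fin d) ℂ) := Matrix.linftyOpNormedAlgebra
  obtain ⟨u, hu⟩ := hA.isUnit_map
  have hinv : (↑u⁻¹ : Matrix (Fin d) (Fin d) ℂ) = Complex.ofRealHom.mapMatrix A⁻¹ := by
    refine (Units.eq_inv_of_mul_eq_one_left ?_).symm
    rw [hu, map_ofReal_eq, ← map_mul, Matrix.mul_nonsing_inv _ hA.isUnit_det, map_one]
  have hlim : Tendsto (fun k : ℕ => (↑u⁻¹ : Matrix (Fin d) (Fin d) ℂ) ^ k) atTop (𝓝 0) := by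
    apply tendsto_pow_zero_of_spectralRadius_lt_one
    refine lt_of_lt_of_le (spectrum.spectralRadius_lt_of_forall_lt (r := 1) _ ?_) (by simp)
    intro z hz
    have hz0 : z ≠ 0 := by
      rintro rfl
      exact (spectrum.zero_notMem_iff ℂ).2 u⁻¹.isUnit hz
    have hz' := (spectrum.inv_mem_iff (r := Units.mk0 z hz0) (a := u⁻¹)).1 hz
    have h1 := hA z⁻¹ (by simpa [hu] using hz')
    rw [norm_inv] at h1
    have hzpos : 0 < ‖z‖ := norm_pos_iff.2 hz0
    have : ‖z‖ < 1 := (one_lt_inv₀ hzpos).1 h1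
    exact_mod_cast this
  refine tendsto_pi_nhds.2 fun i => tendsto_pi_nhds.2 fun j => ?_
  have h1 := (tendsto_pi_nhds.1 ((tendsto_pi_nhds.1 hlim) i)) j
  have h2 := (Complex.continuous_re.tendsto _).comp h1
  refine (h2.congr fun k => ?_).trans (by simp)
  simp only [Function.comp, hinv, ← map_pow]
  simp

/-- Continuity of the determinant gives `(det A)⁻ᵏ → det 0`, and `det 0 = 0` because `d > 0`. -/
theorem IsExpanding.one_lt_abs_det (hd : 0 < d) (hA : IsExpanding A) : 1 < |A.det| := by
  have : Nonempty (Fin d) := ⟨⟨0, hd⟩⟩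
  have h := ((Continuous.matrix_det continuous_id).tendsto
    (0 : Matrix (Fin d) (Fin d) ℝ)).comp (hA.tendsto_inv_pow hd)
  have h2 : Tendsto (fun k : ℕ => (A.det⁻¹) ^ k) atTop (𝓝 0) := by
    refine (h.congr fun k => ?_).trans (by simp)
    simp [Matrix.det_pow, Matrix.det_nonsing_inv]
  rw [tendsto_pow_atTop_nhds_zero_iff, abs_inv] at h2
  exact (inv_lt_one₀ (abs_pos.2 hA.isUnit_det.ne_zero)).1 h2

theorem toEuclideanLin_mul_apply (M N : Matrix (Fin d) (Fin d) ℝ) (x : EuclideanSpace ℝ (Fin d)) :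
    (M * N).toEuclideanLin x = M.toEuclideanLin (N.toEuclideanLin x) := by
  simp [Matrix.toLpLin_apply, Matrix.mulVec_mulVec]

theorem toEuclideanLin_one_apply (x : EuclideanSpace ℝ (Fin d)) :
    (1 : Matrix (Fin d) (Fin d) ℝ).toEuclideanLin x = x := by
  simp

theorem toEuclideanLin_zpow_add_apply (hA : IsExpanding A) (m n : ℤ)
    (x : EuclideanSpace ℝ (Fin d)) :
    (A ^ (m + n)).toEuclideanLin x = (A ^ m).toEuclideanLin ((A ^ n).toEuclideanLin x) := by
  rw [Matrix.zpow_add hA.isUnit_det, toEuclideanLin_mul_apply]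

theorem zpow_neg_natCast_eq (k : ℕ) : A ^ (-(k : ℤ)) = (A⁻¹) ^ k := by
  rw [Matrix.zpow_neg_natCast, Matrix.inv_pow']

theorem exists_bound_toEuclideanLin (M : Matrix (Fin d) (Fin d) ℝ) :
    ∃ C : ℝ, 0 ≤ C ∧ ∀ x : EuclideanSpace ℝ (Fin d), ‖M.toEuclideanLin x‖ ≤ C * ‖x‖ :=
  ⟨‖Matrix.toEuclideanCLM (n := Fin d) (𝕜 := ℝ) M‖, norm_nonneg _, fun x =>
    (Matrix.toEuclideanCLM (n := Fin d) (𝕜 := ℝ) M).le_opNorm x⟩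

theorem IsExpanding.exists_bound_inv_pow (hd : 0 < d) (hA : IsExpanding A) :
    ∃ c : ℕ → ℝ, Tendsto c atTop (𝓝 0) ∧ (∀ k, 0 ≤ c k) ∧
      ∀ k (x : EuclideanSpace ℝ (Fin d)), ‖(A⁻¹ ^ k).toEuclideanLin x‖ ≤ c k * ‖x‖ := by
  refine ⟨fun k => ‖Matrix.toEuclideanCLM (n := Fin d) (𝕜 := ℝ) (A⁻¹ ^ k)‖, ?_,
    fun _ => norm_nonneg _, fun k x =>
    (Matrix.toEuclideanCLM (n := Fin d) (𝕜 := ℝ) (A⁻¹ ^ k)).le_opNorm x⟩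
  have hc : Continuous fun M : Matrix (Fin d) (Fin d) ℝ =>
      Matrix.toEuclideanCLM (n := Fin d) (𝕜 := ℝ) M :=
    LinearMap.continuous_of_finiteDimensional
      (Matrix.toEuclideanCLM (n := Fin d) (𝕜 := ℝ)).toAlgEquiv.toLinearMap
  have := (hc.norm.tendsto 0).comp (hA.tendsto_inv_pow hd)
  simpa [Function.comp_def] using this

/-- The contraction ratio `q^{-1/d}` of `A⁻¹` with respect to the pseudo-norm. -/
noncomputable def ratio (A : Matrix (Fin d) (Fin d) ℝ) : ℝ := |A.det| ^ (-1 / (d : ℝ))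

theorem ratio_pos (hA : IsExpanding A) : 0 < ratio A :=
  Real.rpow_pos_of_pos (abs_pos.2 hA.isUnit_det.ne_zero) _

theorem ratio_lt_one (hd : 0 < d) (hA : IsExpanding A) : ratio A < 1 :=
  Real.rpow_lt_one_of_one_lt_of_neg (hA.one_lt_abs_det hd)
    (div_neg_of_neg_of_pos (by norm_num) (by exact_mod_cast hd))

theorem rpow_neg_div_eq_ratio_zpow (n : ℤ) :
    |A.det| ^ (-(n : ℝ) / (d : ℝ)) = ratio A ^ n := by
  rw [ratio, ← Real.rpow_intCast, ← Real.rpow_mul (abs_nonneg _)]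
  congr 1
  ring

end Expanding

/-! ### The pseudo-norm: scaling and comparison with the Euclidean norm. -/

section PseudoNorm

variable {d : ℕ} {A : Matrix (Fin d) (Fin d) ℝ} {δ : ℝ} {φ : EuclideanSpace ℝ (Fin d) → ℝ}

local notation "𝔼" => EuclideanSpace ℝ (Fin d)

theorem IsKernel.integrable (hφ : IsKernel δ φ) : Integrable φ :=
  integrable_of_integral_eq_one hφ.integral_eq_one

theorem smoothedIndicator_nonneg (hφ : IsKernel δ φ) (x : 𝔼) : 0 ≤ smoothedIndicator A φ x :=
  integral_nonneg fun y => mul_nonneg (indicator_nonneg (fun _ _ => zero_le_one) _) (hφ.nonneg y)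

theorem smoothedIndicator_le_one (hφ : IsKernel δ φ) (x : 𝔼) : smoothedIndicator A φ x ≤ 1 := by
  rw [← hφ.integral_eq_one]
  refine integral_mono_of_nonneg
    (.of_forall fun y => mul_nonneg (indicator_nonneg (fun _ _ => zero_le_one) _) (hφ.nonneg y))
    hφ.integrable (.of_forall fun y => ?_)
  exact mul_le_of_le_one_left (hφ.nonneg y)
    (indicator_le_self' (fun _ _ => zero_le_one) _)

theorem smoothedIndicator_eq_zero (hφ : IsKernel δ φ) {x : 𝔼} (hx : ‖x‖ ≤ 1 - δ) :
    smoothedIndicator A φ x = 0 := by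
  refine integral_eq_zero_of_ae (.of_forall fun y => ?_)
  by_cases hy : φ y = 0
  · simp [hy]
  · have h1 : ‖y‖ < δ := by simpa using hφ.support_subset hy
    have h2 : x - y ∈ Metric.ball (0 : 𝔼) 1 := by
      rw [mem_ball_zero_iff]
      linarith [norm_sub_le x y]
    simp [annulus, h2]

theorem pseudoNorm_eq_tsum (x : 𝔼) : pseudoNorm A φ x =
    ∑' n : ℤ, ratio A ^ n * smoothedIndicator A φ ((A ^ n).toEuclideanLin x) := by
  simp only [pseudoNorm, rpow_neg_div_eq_ratio_zpow]

/-- Shift the summation index by one. Reindexing and scalar multiples are valid for `tsum` without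
summability, so no convergence is needed here. -/
theorem pseudoNorm_inv_apply (hA : IsExpanding A) (x : 𝔼) :
    pseudoNorm A φ ((A⁻¹).toEuclideanLin x) = ratio A * pseudoNorm A φ x := by
  rw [pseudoNorm_eq_tsum, pseudoNorm_eq_tsum, ← tsum_mul_left, ← (Equiv.addRight (1 : ℤ)).tsum_eq]
  refine tsum_congr fun n => ?_
  have h : (A⁻¹).toEuclideanLin x = (A ^ (-1 : ℤ)).toEuclideanLin x := by
    rw [Matrix.zpow_neg_one]
  rw [Equiv.coe_addRight, h, ← toEuclideanLin_zpow_add_apply hA, add_neg_cancel_right,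
    zpow_add_one₀ (ratio_pos hA).ne']
  ring

theorem pseudoNorm_inv_pow_apply (hA : IsExpanding A) (k : ℕ) (x : 𝔼) :
    pseudoNorm A φ ((A⁻¹ ^ k).toEuclideanLin x) = ratio A ^ k * pseudoNorm A φ x := by
  induction k with
  | zero => simp
  | succ k ih =>
    rw [pow_succ', toEuclideanLin_mul_apply, pseudoNorm_inv_apply hA, ih, pow_succ']; ring

theorem pseudoNorm_zero (hd : 0 < d) (hA : IsExpanding A) : pseudoNorm A φ (0 : 𝔼) = 0 := by
  have h := pseudoNorm_inv_apply (φ := φ) hA (0 : 𝔼)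
  rw [map_zero] at h
  have := ratio_lt_one hd hA
  by_contra h0
  exact this.ne (mul_right_cancel₀ h0 (by rw [one_mul]; exact h.symm))

/-- For `‖x‖ ≤ R` and `n < -K`, the point `Aⁿ x` lies in the ball where `h` vanishes. What remains
is dominated by a geometric series starting at `-K`, uniformly in `x`. -/
theorem exists_summable_and_bound (hd : 0 < d) (hA : IsExpanding A) (hδ : δ < 1)
    (hφ : IsKernel δ φ) (R : ℝ) : ∃ C : ℝ, ∀ x : 𝔼, ‖x‖ ≤ R →
      Summable (fun n : ℤ => ratio A ^ n * smoothedIndicator A φ ((A ^ n).toEuclideanLin x)) ∧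
      pseudoNorm A φ x ≤ C := by
  obtain ⟨c, hc, hc0, hcb⟩ := hA.exists_bound_inv_pow hd
  have hc' : Tendsto (fun k => c k * R) atTop (𝓝 0) := by simpa using hc.mul_const R
  obtain ⟨K, hK⟩ := eventually_atTop.1 (hc'.eventually_le_const (sub_pos.2 hδ))
  have hr0 := ratio_pos hA
  have hr1 := ratio_lt_one hd hA
  refine ⟨∑' m : ℕ, (ratio A ^ (K : ℤ))⁻¹ * ratio A ^ m, fun x hx => ?_⟩
  set f : ℤ → ℝ := fun n => ratio A ^ n * smoothedIndicator A φ ((A ^ n).toEuclideanLin x) with hf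
  have hinj : Function.Injective (fun m : ℕ => (m : ℤ) - K) := fun a b h => by
    simpa using h
  have hsupp : ∀ n : ℤ, n ∉ range (fun m : ℕ => (m : ℤ) - K) → f n = 0 := by
    intro n hn
    have hlt : n + K < 0 := by
      by_contra hcon
      exact hn ⟨(n + K).toNat, by simp only; omega⟩
    obtain ⟨m, hm⟩ : ∃ m : ℕ, n = -(m : ℤ) := ⟨(-n).toNat, by omega⟩
    have hKm : K ≤ m := by omega
    have : smoothedIndicator A φ ((A ^ n).toEuclideanLin x) = 0 := by
      apply smoothedIndicator_eq_zero hφ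
      rw [hm, zpow_neg_natCast_eq]
      exact (hcb m x).trans ((mul_le_mul_of_nonneg_left hx (hc0 m)).trans (hK m hKm))
    simp [hf, this]
  have hgeo : Summable fun m : ℕ => (ratio A ^ (K : ℤ))⁻¹ * ratio A ^ m :=
    (summable_geometric_of_lt_one hr0.le hr1).mul_left _
  have hle : ∀ m : ℕ, f ((m : ℤ) - K) ≤ (ratio A ^ (K : ℤ))⁻¹ * ratio A ^ m := by
    intro m
    have : ratio A ^ ((m : ℤ) - K) = (ratio A ^ (K : ℤ))⁻¹ * ratio A ^ m := by
      rw [zpow_sub₀ hr0.ne', zpow_natCast, div_eq_inv_mul]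
    rw [← this]
    exact mul_le_of_le_one_right (zpow_nonneg hr0.le _) (smoothedIndicator_le_one hφ _)
  have hnn : ∀ m : ℕ, 0 ≤ f ((m : ℤ) - K) := fun m =>
    mul_nonneg (zpow_nonneg hr0.le _) (smoothedIndicator_nonneg hφ _)
  have hsumN : Summable fun m : ℕ => f ((m : ℤ) - K) := Summable.of_nonneg_of_le hnn hle hgeo
  refine ⟨(hinj.summable_iff hsupp).1 hsumN, ?_⟩
  rw [pseudoNorm_eq_tsum]
  change ∑' n, f n ≤ _
  rw [← hinj.tsum_eq (f := f) (fun n hn => by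
    by_contra h; exact hn (hsupp n h))]
  exact hsumN.tsum_le_tsum hle hgeo

theorem isOpen_image_ball (hA : IsExpanding A) :
    IsOpen (A.toEuclideanLin '' Metric.ball (0 : 𝔼) 1) := by
  have h1 : ∀ x : 𝔼, (A⁻¹).toEuclideanLin (A.toEuclideanLin x) = x := fun x => by
    rw [← toEuclideanLin_mul_apply, Matrix.nonsing_inv_mul _ hA.isUnit_det,
      toEuclideanLin_one_apply]
  have h2 : ∀ x : 𝔼, A.toEuclideanLin ((A⁻¹).toEuclideanLin x) = x := fun x => by
    rw [← toEuclideanLin_mul_apply, Matrix.mul_nonsing_inv _ hA.isUnit_det,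
      toEuclideanLin_one_apply]
  rw [image_eq_preimage_of_inverse h1 h2]
  exact Metric.isOpen_ball.preimage (LinearMap.continuous_of_finiteDimensional _)

/-- The annulus contains part of the unit sphere and need not be open. Pushing a point slightly
outwards leaves the sphere while staying in the open conditions, so an open piece is found. -/
theorem volume_annulus_inter_pos (hA : IsExpanding A) {O : Set 𝔼} (hO : IsOpen O)
    (h : (annulus A ∩ O).Nonempty) : 0 < volume (annulus A ∩ O) := by
  obtain ⟨x, ⟨hx1, hx2⟩, hxO⟩ := h
  have hU : IsOpen (A.toEuclideanLin '' Metric.ball (0 : 𝔼) 1 ∩ O) := (isOpen_image_ball hA).inter hO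
  have hcont : Continuous fun t : ℝ => t • x := by fun_prop
  have hev : ∀ᶠ t : ℝ in 𝓝 1, t • x ∈ A.toEuclideanLin '' Metric.ball (0 : 𝔼) 1 ∩ O :=
    hcont.continuousAt.eventually_mem (hU.mem_nhds (by simpa using ⟨by simpa using hx1, hxO⟩))
  obtain ⟨t, ht, ht1⟩ := ((hev.filter_mono nhdsWithin_le_nhds).and
    (self_mem_nhdsWithin : Ioi (1 : ℝ) ∈ 𝓝[>] 1)).exists
  have hxn : 1 ≤ ‖x‖ := by simpa using hx2
  have ht1' : (1 : ℝ) < t := ht1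
  have hopen : IsOpen ((A.toEuclideanLin '' Metric.ball (0 : 𝔼) 1 ∩ O) ∩ {y | 1 < ‖y‖}) :=
    hU.inter (isOpen_lt continuous_const continuous_norm)
  refine lt_of_lt_of_le (hopen.measure_pos volume ⟨t • x, ht, ?_⟩) (measure_mono ?_)
  · simp only [mem_ofPred_eq, norm_smul, Real.norm_eq_abs, abs_of_pos (zero_lt_one.trans ht1')]
    nlinarith
  · rintro y ⟨⟨hy1, hy2⟩, hy3⟩
    exact ⟨⟨hy1, by simpa using le_of_lt hy3⟩, hy2⟩

theorem measurableSet_annulus (hA : IsExpanding A) : MeasurableSet (annulus A) :=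
  (isOpen_image_ball hA).measurableSet.diff Metric.isOpen_ball.measurableSet

theorem exists_annulus_bound : ∃ C : ℝ, 0 ≤ C ∧ ∀ x ∈ annulus A, ‖x‖ ≤ C := by
  obtain ⟨C, hC0, hC⟩ := exists_bound_toEuclideanLin A
  refine ⟨C, hC0, ?_⟩
  rintro _ ⟨⟨y, hy, rfl⟩, -⟩
  exact (hC y).trans (mul_le_of_le_one_right hC0 (by simpa using (mem_ball_zero_iff.1 hy).le))

/-- Near the origin `φ ≥ φ 0 / 2`, so `h x` is at least `φ 0 / 2` times the volume of the annulus
near `x`. Finitely many balls of radius `r / 2` cover the annulus, and those meeting it do so in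
volume bounded below; a ball containing `x` lies within distance `r` of `x`. -/
theorem exists_smoothedIndicator_lower_bound (hA : IsExpanding A) (hφ : IsKernel δ φ) :
    ∃ c : ℝ, 0 < c ∧ ∀ x ∈ annulus A, c ≤ smoothedIndicator A φ x := by
  obtain ⟨r, hr, hball⟩ : ∃ r > 0, ∀ y : 𝔼, ‖y‖ < r → φ 0 / 2 ≤ φ y := by
    have hc : ContinuousAt φ 0 := hφ.smooth.continuous.continuousAt
    have := hc.eventually (lt_mem_nhds (half_lt_self hφ.pos_zero))
    obtain ⟨r, hr, h⟩ := Metric.eventually_nhds_iff.1 this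
    exact ⟨r, hr, fun y hy => (h (by simpa using hy)).le⟩
  obtain ⟨C, -, hC⟩ := exists_annulus_bound (A := A)
  obtain ⟨t, ht, hcov⟩ := Metric.totallyBounded_iff.1
    (isCompact_closedBall (0 : 𝔼) C).totallyBounded (r / 2) (half_pos hr)
  have hfin : ∀ c, volume (annulus A ∩ Metric.ball c (r / 2)) ≠ ⊤ := fun c =>
    ((measure_mono inter_subset_right).trans_lt Metric.isBounded_ball.measure_lt_top).ne
  have hmin : ∃ m : ℝ, 0 < m ∧ ∀ c ∈ t, (annulus A ∩ Metric.ball c (r / 2)).Nonempty →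
      m ≤ volume.real (annulus A ∩ Metric.ball c (r / 2)) := by
    have htf : {c ∈ t | (annulus A ∩ Metric.ball c (r / 2)).Nonempty}.Finite := ht.subset fun c hc => hc.1
    rcases eq_empty_or_nonempty {c ∈ t | (annulus A ∩ Metric.ball c (r / 2)).Nonempty} with he | hne
    · refine ⟨1, one_pos, fun c hc hn => ?_⟩
      exact absurd (show c ∈ {c ∈ t | (annulus A ∩ Metric.ball c (r / 2)).Nonempty} from ⟨hc, hn⟩)
        (by rw [he]; exact notMem_empty c)
    · obtain ⟨c0, hc0, hm⟩ := exists_min_image _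
        (fun c => volume.real (annulus A ∩ Metric.ball c (r / 2))) htf hne
      exact ⟨_, ENNReal.toReal_pos (volume_annulus_inter_pos hA Metric.isOpen_ball hc0.2).ne'
        (hfin c0), fun c hc hn => hm c ⟨hc, hn⟩⟩
  obtain ⟨m, hm0, hm⟩ := hmin
  refine ⟨m * (φ 0 / 2), mul_pos hm0 (half_pos hφ.pos_zero), fun x hx => ?_⟩
  obtain ⟨c, hct, hxc⟩ := mem_iUnion₂.1 (hcov (mem_closedBall_zero_iff.2 (hC x hx)))
  have hsub : smoothedIndicator A φ x =
      ∫ z, (annulus A).indicator (fun _ => (1 : ℝ)) z * φ (x - z) := by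
    rw [smoothedIndicator, ← integral_sub_left_eq_self _ volume x]
    simp
  have hle : m * (φ 0 / 2) ≤
      ∫ z, (annulus A ∩ Metric.ball c (r / 2)).indicator (fun _ => φ 0 / 2) z := by
    rw [integral_indicator_const _ ((measurableSet_annulus hA).inter
      Metric.isOpen_ball.measurableSet), smul_eq_mul]
    exact mul_le_mul_of_nonneg_right (hm c hct ⟨x, hx, hxc⟩) (half_pos hφ.pos_zero).le
  refine hle.trans ?_
  rw [hsub]
  refine integral_mono_of_nonneg (.of_forall fun z => indicator_nonneg
    (fun _ _ => (half_pos hφ.pos_zero).le) z) ?_ (.of_forall fun z => ?_)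
  · have := (hφ.integrable.comp_sub_left x).indicator (measurableSet_annulus hA)
    refine this.congr (.of_forall fun z => ?_)
    by_cases hz : z ∈ annulus A <;> simp [hz]
  · have hpos := hφ.nonneg (x - z)
    by_cases hz : z ∈ annulus A
    · by_cases hzb : z ∈ Metric.ball c (r / 2)
      · have : φ 0 / 2 ≤ φ (x - z) := by
          apply hball
          rw [← dist_eq_norm]
          have h1 := Metric.mem_ball.1 hxc
          have h2 := Metric.mem_ball.1 hzb
          linarith [dist_triangle_right x z c]
        simpa [hz, indicator_of_mem (show z ∈ annulus A ∩ Metric.ball c (r / 2) from ⟨hz, hzb⟩)]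
      · simpa [hz, indicator_of_notMem (show z ∉ annulus A ∩ Metric.ball c (r / 2) from
          fun h => hzb h.2)]
    · simp [hz]

/-- Take the greatest `n` with `‖Aⁿ x‖ < 1`: then `Aⁿ⁺¹ x` lies in the image of the unit ball but
not in the ball. The norms need not be monotone in `n`. -/
theorem exists_zpow_mem_annulus (hd : 0 < d) (hA : IsExpanding A) {x : 𝔼} (hx : x ≠ 0) :
    ∃ n : ℤ, (A ^ n).toEuclideanLin x ∈ annulus A := by
  obtain ⟨c, hc, hc0, hcb⟩ := hA.exists_bound_inv_pow hd
  have hxp : 0 < ‖x‖ := norm_pos_iff.2 hx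
  have h1 : ∃ b : ℤ, ∀ n : ℤ, ‖(A ^ n).toEuclideanLin x‖ < 1 → n ≤ b := by
    obtain ⟨K, hK⟩ := eventually_atTop.1 (hc.eventually (gt_mem_nhds hxp))
    refine ⟨K, fun n hn => ?_⟩
    by_contra hcon
    push Not at hcon
    obtain ⟨k, rfl⟩ : ∃ k : ℕ, n = k := ⟨n.toNat, by omega⟩
    have hx' : x = (A⁻¹ ^ k).toEuclideanLin ((A ^ (k : ℤ)).toEuclideanLin x) := by
      rw [← zpow_neg_natCast_eq, ← toEuclideanLin_zpow_add_apply hA, neg_add_cancel, zpow_zero,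
        toEuclideanLin_one_apply]
    have h2 := hcb k ((A ^ (k : ℤ)).toEuclideanLin x)
    rw [← hx'] at h2
    have h3 := hK k (by omega)
    nlinarith [hc0 k]
  have h2 : ∃ n : ℤ, ‖(A ^ n).toEuclideanLin x‖ < 1 := by
    have hc' : Tendsto (fun k => c k * ‖x‖) atTop (𝓝 0) := by simpa using hc.mul_const ‖x‖
    obtain ⟨k, hk⟩ := (hc'.eventually (gt_mem_nhds zero_lt_one)).exists
    exact ⟨-(k : ℤ), by rw [zpow_neg_natCast_eq]; exact (hcb k x).trans_lt hk⟩
  obtain ⟨n, hn, hmax⟩ := Int.exists_greatest_of_bdd h1 h2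
  refine ⟨1 + n, ⟨(A ^ n).toEuclideanLin x, by simpa using hn, ?_⟩, fun h => ?_⟩
  · rw [toEuclideanLin_zpow_add_apply hA, zpow_one]
  · have := hmax (1 + n) (by simpa using h)
    omega

/-- If `Aᵐ x` lies in the annulus, the `m`-th term alone gives `ratio A ^ m * h0 ≤ 1`, hence `m >
-M`. Then `x` is `A ^ M * A⁻¹ ^ (m + M)` applied to a bounded vector, with a natural exponent on the
bounded family `A⁻¹ ^ k`. -/
theorem exists_norm_bound_of_pseudoNorm_le_one (hd : 0 < d) (hA : IsExpanding A) (hδ : δ < 1)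
    (hφ : IsKernel δ φ) : ∃ R : ℝ, 0 ≤ R ∧ ∀ x : 𝔼, pseudoNorm A φ x ≤ 1 → ‖x‖ ≤ R := by
  obtain ⟨c, hc, hc0, hcb⟩ := hA.exists_bound_inv_pow hd
  obtain ⟨S, hS⟩ := hc.bddAbove_range
  obtain ⟨h0, hh0, hh⟩ := exists_smoothedIndicator_lower_bound hA hφ
  obtain ⟨CV, hCV0, hCV⟩ := exists_annulus_bound (A := A)
  have hr0 := ratio_pos hA
  have hr1 := ratio_lt_one hd hA
  obtain ⟨M, hM⟩ := exists_pow_lt_of_lt_one hh0 hr1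
  obtain ⟨D, hD0, hD⟩ := exists_bound_toEuclideanLin (A ^ M)
  have hS0 : 0 ≤ S := (hc0 0).trans (hS ⟨0, rfl⟩)
  refine ⟨D * (S * CV), by positivity, fun x hx => ?_⟩
  rcases eq_or_ne x 0 with rfl | hx0
  · simpa using (by positivity : 0 ≤ D * (S * CV))
  obtain ⟨m, hm⟩ := exists_zpow_mem_annulus hd hA hx0
  obtain ⟨C, hC⟩ := exists_summable_and_bound hd hA hδ hφ ‖x‖
  have hsum := (hC x le_rfl).1
  have hterm : ratio A ^ m * h0 ≤ 1 := by
    refine le_trans ?_ hx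
    rw [pseudoNorm_eq_tsum]
    refine (mul_le_mul_of_nonneg_left (hh _ hm) (zpow_nonneg hr0.le _)).trans
      (hsum.le_tsum m fun n _ => mul_nonneg (zpow_nonneg hr0.le _) (smoothedIndicator_nonneg hφ _))
  have hmM : -(M : ℤ) < m := by
    by_contra hcon
    push Not at hcon
    have h1 : ratio A ^ (-(M : ℤ)) ≤ ratio A ^ m :=
      zpow_le_zpow_right_of_le_one₀ hr0 hr1.le hcon
    have h2 : ratio A ^ (-(M : ℤ)) * ratio A ^ M = 1 := by
      rw [zpow_neg, zpow_natCast, inv_mul_cancel₀ (pow_pos hr0 M).ne']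
    have h3 : 0 < ratio A ^ (-(M : ℤ)) := zpow_pos hr0 _
    nlinarith
  obtain ⟨k, hk⟩ : ∃ k : ℕ, m + M = k := ⟨(m + M).toNat, by omega⟩
  have hx' : x = (A ^ M).toEuclideanLin
      ((A⁻¹ ^ k).toEuclideanLin ((A ^ m).toEuclideanLin x)) := by
    rw [← zpow_neg_natCast_eq, ← zpow_natCast, ← toEuclideanLin_zpow_add_apply hA,
      ← toEuclideanLin_zpow_add_apply hA, show (M : ℤ) + -(k : ℤ) + m = 0 by omega, zpow_zero,
      toEuclideanLin_one_apply]
  calc ‖x‖ ≤ D * ‖(A⁻¹ ^ k).toEuclideanLin ((A ^ m).toEuclideanLin x)‖ := by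
        conv_lhs => rw [hx']
        exact hD _
    _ ≤ D * (S * CV) := by
        refine mul_le_mul_of_nonneg_left ((hcb k _).trans ?_) hD0
        exact mul_le_mul (hS ⟨k, rfl⟩) (hCV _ hm) (norm_nonneg _) hS0

theorem inv_pow_apply_pow_apply (hA : IsExpanding A) (k : ℕ) (x : 𝔼) :
    (A⁻¹ ^ k).toEuclideanLin ((A ^ k).toEuclideanLin x) = x := by
  rw [← toEuclideanLin_mul_apply, Matrix.inv_pow', Matrix.nonsing_inv_mul _
    (by rw [Matrix.det_pow]; exact hA.isUnit_det.pow k), toEuclideanLin_one_apply]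

theorem pseudoNorm_pow_apply (hA : IsExpanding A) (k : ℕ) (x : 𝔼) :
    ratio A ^ k * pseudoNorm A φ ((A ^ k).toEuclideanLin x) = pseudoNorm A φ x := by
  rw [← pseudoNorm_inv_pow_apply hA, inv_pow_apply_pow_apply hA]

/-- Blow up by `A ^ k` to reach pseudo-norm at most one, apply the previous bound, and scale back.
This is how smallness in the pseudo-norm passes to the Euclidean topology; no triangle inequality
for the pseudo-norm is needed. -/
theorem exists_pseudoNorm_le_imp_norm_lt (hd : 0 < d) (hA : IsExpanding A) (hδ : δ < 1)
    (hφ : IsKernel δ φ) {r : ℝ} (hr : 0 < r) :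
    ∃ ε : ℝ, 0 < ε ∧ ∀ x : 𝔼, pseudoNorm A φ x ≤ ε → ‖x‖ < r := by
  obtain ⟨c, hc, hc0, hcb⟩ := hA.exists_bound_inv_pow hd
  obtain ⟨R, hR0, hR⟩ := exists_norm_bound_of_pseudoNorm_le_one hd hA hδ hφ
  have hc' : Tendsto (fun k => c k * R) atTop (𝓝 0) := by simpa using hc.mul_const R
  obtain ⟨k, hk⟩ := (hc'.eventually (gt_mem_nhds hr)).exists
  have hp := pow_pos (ratio_pos hA) k
  refine ⟨ratio A ^ k, hp, fun x hx => ?_⟩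
  rw [← pseudoNorm_pow_apply hA k, mul_le_iff_le_one_right hp] at hx
  have h1 := hcb k ((A ^ k).toEuclideanLin x)
  rw [inv_pow_apply_pow_apply hA] at h1
  exact h1.trans_lt ((mul_le_mul_of_nonneg_left (hR _ hx) (hc0 k)).trans_lt hk)

end PseudoNorm

end LinearGIFS

namespace LinearGIFS

/-! ### Hausdorff measure for the pseudo-norm. -/

section OmegaMeasure

variable {d : ℕ} {A : Matrix (Fin d) (Fin d) ℝ} {δ : ℝ} {φ : EuclideanSpace ℝ (Fin d) → ℝ}

local notation "𝔼" => EuclideanSpace ℝ (Fin d)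

theorem ofReal_pseudoNorm_le_omegaDiam {T : Set 𝔼} {x y : 𝔼} (hx : x ∈ T) (hy : y ∈ T) :
    ENNReal.ofReal (pseudoNorm A φ (x - y)) ≤ omegaDiam A φ T :=
  le_trans (le_iSup₂_of_le (f := fun y (_ : y ∈ T) => ENNReal.ofReal (pseudoNorm A φ (x - y)))
    y hy le_rfl)
    (le_iSup₂_of_le (f := fun x (_ : x ∈ T) => ⨆ y ∈ T, ENNReal.ofReal (pseudoNorm A φ (x - y)))
      x hx le_rfl)

theorem omegaDiam_le_iff {T : Set 𝔼} {D : ℝ≥0∞} : omegaDiam A φ T ≤ D ↔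
    ∀ x ∈ T, ∀ y ∈ T, ENNReal.ofReal (pseudoNorm A φ (x - y)) ≤ D := by
  simp only [omegaDiam, iSup_le_iff]

variable (A φ) in
/-- The outer measure `H_{ω,ε}^s`. -/
noncomputable def omegaPreOuter (s : ℝ) (ε : ℝ≥0∞) : OuterMeasure 𝔼 :=
  OuterMeasure.boundedBy (extend (P := fun T => omegaDiam A φ T ≤ ε) fun T _ => omegaDiam A φ T ^ s)

variable (A φ) in
/-- The outer measure `H_ω^s`. -/
noncomputable def omegaOuter (s : ℝ) : OuterMeasure 𝔼 :=
  ⨆ (ε : ℝ≥0∞) (_ : 0 < ε), omegaPreOuter A φ s ε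

/-- Sets of diameter above `ε` get the value `∞` and drop out of the infimum. The identification
provides countable subadditivity and the Carathéodory construction. -/
theorem omegaPreOuter_apply (s : ℝ) (ε : ℝ≥0∞) (S : Set 𝔼) :
    omegaPreOuter A φ s ε S = omegaHausdorffPre A φ s ε S := by
  classical
  simp only [omegaPreOuter, omegaHausdorffPre, OuterMeasure.boundedBy_apply, extend]
  refine iInf_congr fun t => iInf_congr fun ht => ?_
  by_cases htr : ∀ n, omegaDiam A φ (t n) ≤ ε
  · rw [iInf_eq_if, if_pos htr]
    congr 1 with n : 1
    simp only [iInf_eq_if, htr n, if_true]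
  · rw [iInf_eq_if, if_neg htr]
    push Not at htr
    obtain ⟨n, hn⟩ := htr
    refine ENNReal.tsum_eq_top_of_eq_top ⟨n, ?_⟩
    have hne : (t n).Nonempty := by
      by_contra h
      rw [not_nonempty_iff_eq_empty.1 h] at hn
      simp [omegaDiam] at hn
    rw [iSup_eq_if, if_pos hne, iInf_eq_if, if_neg hn.not_ge]

theorem omegaOuter_apply (s : ℝ) (S : Set 𝔼) :
    omegaOuter A φ s S = omegaHausdorff A φ s S := by
  simp only [omegaOuter, omegaHausdorff, OuterMeasure.iSup_apply, omegaPreOuter_apply]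

theorem omegaHausdorffPre_anti (s : ℝ) {ε ε' : ℝ≥0∞} (h : ε ≤ ε') (S : Set 𝔼) :
    omegaHausdorffPre A φ s ε' S ≤ omegaHausdorffPre A φ s ε S :=
  iInf_mono fun _ => iInf_mono fun _ => iInf_mono' fun hT => ⟨fun i => (hT i).trans h, le_rfl⟩

theorem omegaHausdorffPre_le (s : ℝ) {ε : ℝ≥0∞} (hε : 0 < ε) (S : Set 𝔼) :
    omegaHausdorffPre A φ s ε S ≤ omegaHausdorff A φ s S :=
  le_iSup₂_of_le (f := fun ε (_ : 0 < ε) => omegaHausdorffPre A φ s ε S) ε hε le_rfl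

theorem omegaHausdorffPre_union (s : ℝ) {ε : ℝ≥0∞} {S T : Set 𝔼}
    (h : ∀ x ∈ S, ∀ y ∈ T, ε < ENNReal.ofReal (pseudoNorm A φ (x - y))) :
    omegaHausdorffPre A φ s ε (S ∪ T) =
      omegaHausdorffPre A φ s ε S + omegaHausdorffPre A φ s ε T := by
  rw [← omegaPreOuter_apply, ← omegaPreOuter_apply, ← omegaPreOuter_apply]
  refine OuterMeasure.boundedBy_union_of_top_of_nonempty_inter ?_
  rintro u ⟨x, hxs, hxu⟩ ⟨y, hyt, hyu⟩
  have := (h x hxs y hyt).trans_le (ofReal_pseudoNorm_le_omegaDiam hxu hyu)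
  exact iInf_eq_top.2 fun h => (this.not_ge h).elim

/-- Sets at positive Euclidean distance are also separated in the pseudo-norm, so no set of small
diameter meets both. Borel sets are therefore measurable. -/
theorem isMetric_omegaOuter (hd : 0 < d) (hA : IsExpanding A) (hδ : δ < 1)
    (hφ : IsKernel δ φ) (s : ℝ) : (omegaOuter A φ s).IsMetric := by
  rintro S T ⟨r, hr0, hr⟩
  refine le_antisymm (measure_union_le _ _) ?_
  obtain ⟨r', hr'0, hr'⟩ := ENNReal.lt_iff_exists_real_btwn.1 (pos_iff_ne_zero.2 hr0)
  obtain ⟨hr'1, hr'2⟩ := hr'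
  have hrpos : 0 < r' := ENNReal.ofReal_pos.1 hr'1
  obtain ⟨ε, hε, hεb⟩ := exists_pseudoNorm_le_imp_norm_lt hd hA hδ hφ hrpos
  have hsep : ∀ x ∈ S, ∀ y ∈ T, ENNReal.ofReal ε < ENNReal.ofReal (pseudoNorm A φ (x - y)) := by
    intro x hx y hy
    have h1 := hr'2.trans_le (hr x hx y hy)
    rw [edist_dist, ENNReal.ofReal_lt_ofReal_iff_of_nonneg hr'0, dist_eq_norm] at h1
    have h2 : ε < pseudoNorm A φ (x - y) := by
      by_contra hcon
      exact (hεb _ (not_lt.1 hcon)).not_gt h1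
    exact (ENNReal.ofReal_lt_ofReal_iff_of_nonneg hε.le).2 h2
  rw [omegaOuter_apply, omegaOuter_apply, omegaOuter_apply]
  refine ENNReal.biSup_add_biSup_le' ⟨1, one_pos⟩ ⟨1, one_pos⟩ fun ε₁ h₁ ε₂ h₂ => ?_
  have hpos : 0 < min (min ε₁ ε₂) (ENNReal.ofReal ε) :=
    lt_min (lt_min h₁ h₂) (ENNReal.ofReal_pos.2 hε)
  refine le_trans (add_le_add
    (omegaHausdorffPre_anti (ε := min (min ε₁ ε₂) (ENNReal.ofReal ε)) s
      ((min_le_left _ _).trans (min_le_left _ _)) S)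
    (omegaHausdorffPre_anti (ε := min (min ε₁ ε₂) (ENNReal.ofReal ε)) s
      ((min_le_left _ _).trans (min_le_right _ _)) T)) ?_
  rw [← omegaHausdorffPre_union s fun x hx y hy => (min_le_right _ _).trans_lt (hsep x hx y hy)]
  exact omegaHausdorffPre_le s hpos _

theorem exists_measure_eq_omegaHausdorff (hd : 0 < d) (hA : IsExpanding A) (hδ : δ < 1)
    (hφ : IsKernel δ φ) (s : ℝ) :
    ∃ μ : Measure 𝔼, ∀ B, MeasurableSet B → μ B = omegaHausdorff A φ s B := by
  have hle : (inferInstance : MeasurableSpace 𝔼) ≤ (omegaOuter A φ s).caratheodory := by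
    rw [BorelSpace.measurable_eq (α := 𝔼)]
    exact (isMetric_omegaOuter hd hA hδ hφ s).borel_le_caratheodory
  exact ⟨(omegaOuter A φ s).toMeasure hle, fun B hB => by
    rw [toMeasure_apply _ _ hB, omegaOuter_apply]⟩

theorem omegaHausdorff_mono (s : ℝ) {S T : Set 𝔼} (h : S ⊆ T) :
    omegaHausdorff A φ s S ≤ omegaHausdorff A φ s T := by
  rw [← omegaOuter_apply, ← omegaOuter_apply]
  exact measure_mono h

theorem omegaHausdorff_union_le (s : ℝ) (S T : Set 𝔼) :
    omegaHausdorff A φ s (S ∪ T) ≤ omegaHausdorff A φ s S + omegaHausdorff A φ s T := by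
  simp only [← omegaOuter_apply]
  exact measure_union_le _ _

theorem omegaHausdorff_biUnion_finset_le {ι : Type*} (s : ℝ) (I : Finset ι) (f : ι → Set 𝔼) :
    omegaHausdorff A φ s (⋃ i ∈ I, f i) ≤ ∑ i ∈ I, omegaHausdorff A φ s (f i) := by
  simp only [← omegaOuter_apply]
  exact measure_biUnion_finset_le _ _

theorem omegaDiam_image_le {g : 𝔼 → 𝔼} {c : ℝ} (hc : 0 ≤ c)
    (hg : ∀ x y, pseudoNorm A φ (g x - g y) = c * pseudoNorm A φ (x - y)) (T : Set 𝔼) :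
    omegaDiam A φ (g '' T) ≤ ENNReal.ofReal c * omegaDiam A φ T := by
  rw [omegaDiam_le_iff]
  rintro _ ⟨x, hx, rfl⟩ _ ⟨y, hy, rfl⟩
  rw [hg, ENNReal.ofReal_mul hc]
  gcongr
  exact ofReal_pseudoNorm_le_omegaDiam hx hy

theorem omegaHausdorff_image_le {g : 𝔼 → 𝔼} {c s : ℝ} (hc : 0 < c) (hc1 : c ≤ 1) (hs : 0 ≤ s)
    (hg : ∀ x y, pseudoNorm A φ (g x - g y) = c * pseudoNorm A φ (x - y)) (S : Set 𝔼) :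
    omegaHausdorff A φ s (g '' S) ≤ ENNReal.ofReal c ^ s * omegaHausdorff A φ s S := by
  have hc0 : ENNReal.ofReal c ^ s ≠ 0 :=
    (ENNReal.rpow_pos (ENNReal.ofReal_pos.2 hc) ENNReal.ofReal_ne_top).ne'
  have hct : ENNReal.ofReal c ^ s ≠ ⊤ := ENNReal.rpow_ne_top_of_nonneg hs ENNReal.ofReal_ne_top
  refine iSup₂_le fun ε hε => le_trans ?_ (mul_le_mul_right (omegaHausdorffPre_le s hε S) _)
  rw [omegaHausdorffPre, omegaHausdorffPre]
  simp only [ENNReal.mul_iInf_of_ne hc0 hct, ← ENNReal.tsum_mul_left]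
  refine le_iInf fun T => le_iInf fun hT => le_iInf fun hTd => ?_
  refine iInf_le_of_le (fun i => g '' T i) (iInf_le_of_le ?_ (iInf_le_of_le (fun i => ?_) ?_))
  · rw [← image_iUnion]
    exact image_mono hT
  · refine (omegaDiam_image_le hc.le hg _).trans ((mul_le_mul' ?_ (hTd i)).trans_eq (one_mul _))
    simpa using hc1
  · refine ENNReal.tsum_le_tsum fun i => iSup_le fun hne => ?_
    rw [iSup_pos (image_nonempty.1 hne), ← ENNReal.mul_rpow_of_nonneg _ _ hs]
    exact ENNReal.rpow_le_rpow (omegaDiam_image_le hc.le hg _) hs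

/-- The mass distribution principle, for outer measures, so that the covering sets may be arbitrary.
-/
theorem outerMeasure_le_mul_omegaHausdorff {ν : OuterMeasure 𝔼} {C : ℝ≥0∞} (hC0 : C ≠ 0)
    (hC : C ≠ ⊤) {s : ℝ}
    (h : ∀ T : Set 𝔼, omegaDiam A φ T ≤ 1 → ν T ≤ C * omegaDiam A φ T ^ s) (S : Set 𝔼) :
    ν S ≤ C * omegaHausdorff A φ s S := by
  refine le_trans ?_ (mul_le_mul_right (omegaHausdorffPre_le s one_pos S) _)
  rw [omegaHausdorffPre]
  simp only [ENNReal.mul_iInf_of_ne hC0 hC, ← ENNReal.tsum_mul_left]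
  refine le_iInf fun T => le_iInf fun hT => le_iInf fun hTd => ?_
  refine (measure_mono hT).trans ((measure_iUnion_le _).trans (ENNReal.tsum_le_tsum fun i => ?_))
  rcases eq_empty_or_nonempty (T i) with he | hne
  · simp [he]
  · rw [iSup_pos hne]
    exact h _ (hTd i)

/-- A cover of `I` is carried to a cover of the image with `diam^s ≤ c^s diam`, and one-dimensional
Hausdorff measure on `ℝ` is Lebesgue measure. It serves both for finiteness and for images of null
sets. -/
theorem omegaHausdorff_image_le_of_holder {ψ : ℝ → 𝔼} {c s : ℝ} {I : Set ℝ} (hc : 0 < c)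
    (hs : 0 < s)
    (hψ : ∀ x ∈ I, ∀ y ∈ I, pseudoNorm A φ (ψ x - ψ y) ≤ c * |x - y| ^ (1 / s)) :
    omegaHausdorff A φ s (ψ '' I) ≤ ENNReal.ofReal c ^ s * volume I := by
  have hc0 : ENNReal.ofReal c ≠ 0 := (ENNReal.ofReal_pos.2 hc).ne'
  have hcs0 : ENNReal.ofReal c ^ s ≠ 0 :=
    (ENNReal.rpow_pos (ENNReal.ofReal_pos.2 hc) ENNReal.ofReal_ne_top).ne'
  have hcst : ENNReal.ofReal c ^ s ≠ ⊤ := ENNReal.rpow_ne_top_of_nonneg hs.le ENNReal.ofReal_ne_top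
  have hdiam : ∀ t : Set ℝ, omegaDiam A φ (ψ '' (t ∩ I)) ≤
      ENNReal.ofReal c * Metric.ediam t ^ (1 / s) := by
    intro t
    rw [omegaDiam_le_iff]
    rintro _ ⟨x, ⟨hxt, hx⟩, rfl⟩ _ ⟨y, ⟨hyt, hy⟩, rfl⟩
    refine (ENNReal.ofReal_le_ofReal (hψ x hx y hy)).trans ?_
    rw [ENNReal.ofReal_mul hc.le, ← ENNReal.ofReal_rpow_of_nonneg (abs_nonneg _) (by positivity),
      ← Real.dist_eq, ← edist_dist]
    gcongr
    exact Metric.edist_le_ediam_of_mem hxt hyt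
  rw [← hausdorffMeasure_real, Measure.hausdorffMeasure_apply]
  refine iSup₂_le fun ε hε => ?_
  -- This threshold on diameters in `ℝ` makes the image sets have diameter at most `ε`.
  have hr : 0 < (ε / ENNReal.ofReal c) ^ s := by
    rcases eq_or_ne ε ⊤ with rfl | hεt
    · rw [ENNReal.top_div_of_ne_top ENNReal.ofReal_ne_top, ENNReal.top_rpow_of_pos hs]
      exact ENNReal.zero_lt_top
    · exact ENNReal.rpow_pos (ENNReal.div_pos hε.ne' ENNReal.ofReal_ne_top)
        (ENNReal.div_ne_top hεt hc0)
  refine le_trans ?_ (mul_le_mul_right (le_iSup₂_of_le _ hr le_rfl) _)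
  rw [omegaHausdorffPre]
  simp only [ENNReal.mul_iInf_of_ne hcs0 hcst, ← ENNReal.tsum_mul_left]
  refine le_iInf fun T => le_iInf fun hT => le_iInf fun hTd => ?_
  refine iInf_le_of_le (fun i => ψ '' (T i ∩ I)) (iInf_le_of_le ?_ (iInf_le_of_le (fun i => ?_) ?_))
  · rw [← image_iUnion, ← iUnion_inter]
    exact image_mono fun x hx => ⟨hT hx, hx⟩
  · refine (hdiam _).trans ?_
    refine (mul_le_mul_right (ENNReal.rpow_le_rpow (hTd i) (by positivity)) _).trans ?_
    rw [← ENNReal.rpow_mul, mul_one_div_cancel hs.ne', ENNReal.rpow_one]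
    exact ENNReal.mul_div_le
  · refine ENNReal.tsum_le_tsum fun i => iSup_le fun hne => ?_
    rw [iSup_pos ((image_nonempty.1 hne).mono inter_subset_left)]
    refine (ENNReal.rpow_le_rpow (hdiam _) hs.le).trans ?_
    rw [ENNReal.mul_rpow_of_nonneg _ _ hs.le, ← ENNReal.rpow_mul, one_div_mul_cancel hs.ne']

theorem omegaHausdorffPre_le_rpow_mul {s t : ℝ} (hs : 0 ≤ s) (hst : s < t) {ε : ℝ≥0∞}
    (hε : 0 < ε) (hεt : ε ≠ ⊤) (S : Set 𝔼) :
    omegaHausdorffPre A φ t ε S ≤ ε ^ (t - s) * omegaHausdorffPre A φ s ε S := by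
  have h0 : ε ^ (t - s) ≠ 0 := (ENNReal.rpow_pos hε hεt).ne'
  have ht : ε ^ (t - s) ≠ ⊤ := ENNReal.rpow_ne_top_of_nonneg (sub_pos.2 hst).le hεt
  rw [omegaHausdorffPre, omegaHausdorffPre]
  simp only [ENNReal.mul_iInf_of_ne h0 ht, ← ENNReal.tsum_mul_left]
  refine iInf_mono fun T => iInf_mono fun hT => iInf_mono fun hTd => ?_
  refine ENNReal.tsum_le_tsum fun i => iSup_le fun hne => ?_
  rw [iSup_pos hne]
  have h := ENNReal.rpow_add_of_nonneg (x := omegaDiam A φ (T i)) (t - s) s (sub_pos.2 hst).le hs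
  rw [sub_add_cancel] at h
  rw [h]
  exact mul_le_mul_left (ENNReal.rpow_le_rpow (hTd i) (sub_pos.2 hst).le) _

theorem omegaHausdorff_eq_zero_of_lt {s t : ℝ} (hs : 0 ≤ s) (hst : s < t) {S : Set 𝔼}
    (h : omegaHausdorff A φ s S ≠ ⊤) : omegaHausdorff A φ t S = 0 := by
  have hts := sub_pos.2 hst
  refine le_antisymm (iSup₂_le fun ε hε => ?_) zero_le
  have hlim : Filter.Tendsto (fun η : ℝ≥0∞ => η ^ (t - s) * omegaHausdorff A φ s S)
      (nhdsWithin 0 (Ioi 0)) (nhds 0) := by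
    have h1 : Filter.Tendsto (fun η : ℝ≥0∞ => η ^ (t - s)) (nhds 0) (nhds 0) := by
      simpa [ENNReal.zero_rpow_of_pos hts] using
        (ENNReal.continuous_rpow_const (y := t - s)).tendsto 0
    simpa using ENNReal.Tendsto.mul_const (h1.mono_left nhdsWithin_le_nhds) (Or.inr h)
  refine ge_of_tendsto hlim ?_
  filter_upwards [Ioo_mem_nhdsGT (show (0 : ℝ≥0∞) < min ε ⊤ from lt_min hε ENNReal.zero_lt_top)]
    with η hη
  exact (omegaHausdorffPre_anti t (hη.2.le.trans (min_le_left _ _)) S).trans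
    ((omegaHausdorffPre_le_rpow_mul hs hst hη.1 (hη.2.trans_le (min_le_right _ _)).ne S).trans
      (mul_le_mul_right (omegaHausdorffPre_le s hη.1 S) _))

theorem omegaDim_eq {s : ℝ} (hs : 0 ≤ s) {S : Set 𝔼} (h0 : omegaHausdorff A φ s S ≠ 0)
    (ht : omegaHausdorff A φ s S ≠ ⊤) : omegaDim A φ S = s := by
  have hlb : ∀ t ∈ {t : ℝ | 0 ≤ t ∧ omegaHausdorff A φ t S = 0}, s ≤ t := by
    rintro t ⟨ht0, htz⟩
    by_contra hcon
    exact h0 (omegaHausdorff_eq_zero_of_lt ht0 (not_le.1 hcon) (by simp [htz]))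
  have hmem : ∀ t, s < t → t ∈ {t : ℝ | 0 ≤ t ∧ omegaHausdorff A φ t S = 0} := fun t hst =>
    ⟨hs.trans hst.le, omegaHausdorff_eq_zero_of_lt hs hst ht⟩
  refine le_antisymm (le_of_forall_gt_imp_ge_of_dense fun t hst => ?_)
    (le_csInf ⟨s + 1, hmem _ (by linarith)⟩ hlb)
  exact csInf_le ⟨s, hlb⟩ (hmem t hst)

end OmegaMeasure

end LinearGIFS

namespace LinearGIFS

/-! ### Perron–Frobenius theory of primitive matrices. -/

section PerronFrobenius

open Matrix

variable {V : Type*} [Fintype V]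

theorem mulVec_pos_of_pos {P : Matrix V V ℝ} (hP : ∀ i j, 0 < P i j) {x : V → ℝ}
    (hx : ∀ i, 0 ≤ x i) (hx0 : x ≠ 0) (i : V) : 0 < (P *ᵥ x) i := by
  obtain ⟨j, hj⟩ := Function.ne_iff.1 hx0
  exact Finset.sum_pos' (fun k _ => mul_nonneg (hP i k).le (hx k))
    ⟨j, Finset.mem_univ j, mul_pos (hP i j) (lt_of_le_of_ne (hx j) (Ne.symm hj))⟩

theorem pow_mulVec_eq_smul [DecidableEq V] {B : Matrix V V ℝ} {v : V → ℝ} {r : ℝ}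
    (h : B *ᵥ v = r • v) (n : ℕ) : (B ^ n) *ᵥ v = r ^ n • v := by
  induction n with
  | zero => simp
  | succ n ih => rw [pow_succ, ← mulVec_mulVec, h, mulVec_smul, ih, smul_smul, pow_succ']

theorem le_sum_of_smul_le_mulVec {B : Matrix V V ℝ} (hB : ∀ i j, 0 ≤ B i j) {x : V → ℝ}
    (hx : x ∈ stdSimplex ℝ V) {t : ℝ} (h : ∀ i, t * x i ≤ (B *ᵥ x) i) : t ≤ ∑ i, ∑ j, B i j := by
  calc t = ∑ i, t * x i := by rw [← Finset.mul_sum, hx.2, mul_one]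
    _ ≤ ∑ i, (B *ᵥ x) i := Finset.sum_le_sum fun i _ => h i
    _ ≤ ∑ i, ∑ j, B i j := by
      refine Finset.sum_le_sum fun i _ => Finset.sum_le_sum fun j _ => ?_
      refine mul_le_of_le_one_right (hB i j) ?_
      rw [← hx.2]
      exact Finset.single_le_sum (fun k _ => hx.1 k) (Finset.mem_univ j)

/-- The Collatz–Wielandt number: the largest `t` with `t x ≤ B x` for some `x` in the simplex. It is
attained by compactness, as `t` is bounded by the sum of the entries. -/
theorem exists_max_smul_le_mulVec [Nonempty V] {B : Matrix V V ℝ} (hB : ∀ i j, 0 ≤ B i j) :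
    ∃ r : ℝ, 0 ≤ r ∧ ∃ x ∈ stdSimplex ℝ V, (∀ i, r * x i ≤ (B *ᵥ x) i) ∧
      ∀ t, ∀ y ∈ stdSimplex ℝ V, (∀ i, t * y i ≤ (B *ᵥ y) i) → t ≤ r := by
  classical
  set C := ∑ i, ∑ j, B i j
  have hC : 0 ≤ C := Finset.sum_nonneg fun i _ => Finset.sum_nonneg fun j _ => hB i j
  have hcl : IsClosed {p : ℝ × (V → ℝ) | ∀ i, p.1 * p.2 i ≤ (B *ᵥ p.2) i} := by
    rw [ofPred_forall]
    refine isClosed_iInter fun i => isClosed_le (by fun_prop) ?_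
    exact (continuous_apply i).comp (continuous_const.matrix_mulVec continuous_snd)
  have hK : IsCompact ((Icc (0 : ℝ) C ×ˢ stdSimplex ℝ V) ∩
      {p : ℝ × (V → ℝ) | ∀ i, p.1 * p.2 i ≤ (B *ᵥ p.2) i}) :=
    (isCompact_Icc.prod (isCompact_stdSimplex ℝ V)).inter_right hcl
  obtain ⟨i₀⟩ := ‹Nonempty V›
  have hne : ((Icc (0 : ℝ) C ×ˢ stdSimplex ℝ V) ∩
      {p : ℝ × (V → ℝ) | ∀ i, p.1 * p.2 i ≤ (B *ᵥ p.2) i}).Nonempty := by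
    have hs := single_mem_stdSimplex ℝ i₀
    refine ⟨(0, Pi.single i₀ 1), ⟨⟨le_rfl, hC⟩, hs⟩, fun i => ?_⟩
    rw [zero_mul]
    exact Finset.sum_nonneg fun j _ => mul_nonneg (hB i j) (hs.1 j)
  obtain ⟨⟨r, x⟩, ⟨⟨hr, hx⟩, hrx⟩, hmax⟩ := hK.exists_isMaxOn hne continuous_fst.continuousOn
  refine ⟨r, hr.1, x, hx, hrx, fun t y hy hty => ?_⟩
  rcases lt_or_ge t 0 with ht | ht
  · exact ht.le.trans hr.1
  · exact hmax (a := (t, y)) ⟨⟨⟨ht, le_sum_of_smul_le_mulVec hB hy hty⟩, hy⟩, hty⟩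

/-- A primitive matrix has a positive eigenvector. -/
theorem exists_pos_eigenvector [Nonempty V] [DecidableEq V] {B : Matrix V V ℝ}
    (hB : B.IsPrimitive) :
    ∃ r : ℝ, 0 < r ∧ ∃ v : V → ℝ, (∀ i, 0 < v i) ∧ B *ᵥ v = r • v := by
  obtain ⟨n, hn, hP⟩ := hB.exists_pos_pow
  obtain ⟨r, hr, x, hx, hrx, hmax⟩ := exists_max_smul_le_mulVec hB.nonneg
  have hx0 : x ≠ 0 := by
    rintro rfl
    simpa using hx.2
  have heig : B *ᵥ x = r • x := by
    -- Otherwise `B x - r x ≥ 0` is nonzero and `B ^ n` makes it strictly positive. Then `y = B ^ n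
    -- x` admits a factor `r + ε`, against maximality.
    by_contra hne
    have hz : ∀ i, 0 ≤ (B *ᵥ x - r • x) i := fun i => by
      simpa using hrx i
    have hpos := mulVec_pos_of_pos hP hz (sub_ne_zero.2 hne)
    set y := (B ^ n) *ᵥ x with hy
    have hypos : ∀ i, 0 < y i := mulVec_pos_of_pos hP hx.1 hx0
    have hBy : (B ^ n) *ᵥ (B *ᵥ x - r • x) = B *ᵥ y - r • y := by
      rw [mulVec_sub, mulVec_smul, mulVec_mulVec, hy, mulVec_mulVec, ← pow_succ, ← pow_succ']
    rw [hBy] at hpos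
    obtain ⟨i₀, hi₀⟩ := Finite.exists_min fun i => (B *ᵥ y - r • y) i / y i
    set ε := (B *ᵥ y - r • y) i₀ / y i₀
    have hε : 0 < ε := div_pos (hpos i₀) (hypos i₀)
    have hs : 0 < ∑ i, y i := Finset.sum_pos (fun i _ => hypos i) Finset.univ_nonempty
    have := hmax (r + ε) ((∑ i, y i)⁻¹ • y) ⟨fun i => ?_, ?_⟩ fun i => ?_
    · linarith
    · exact mul_nonneg (inv_nonneg.2 hs.le) (hypos i).le
    · simp only [Pi.smul_apply, smul_eq_mul, ← Finset.mul_sum]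
      exact inv_mul_cancel₀ hs.ne'
    · rw [mulVec_smul]
      simp only [Pi.smul_apply, smul_eq_mul]
      have h1 := (le_div_iff₀ (hypos i)).1 (hi₀ i)
      simp only [Pi.sub_apply, Pi.smul_apply, smul_eq_mul] at h1
      have h2 : (r + ε) * y i ≤ (B *ᵥ y) i := by
        rw [add_mul]
        linarith
      calc (r + ε) * ((∑ i, y i)⁻¹ * y i) = (∑ i, y i)⁻¹ * ((r + ε) * y i) := by ring
        _ ≤ _ := mul_le_mul_of_nonneg_left h2 (inv_nonneg.2 hs.le)
  have hpow : ∀ i, 0 < r ^ n * x i := fun i => by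
    have := mulVec_pos_of_pos hP hx.1 hx0 i
    rwa [pow_mulVec_eq_smul heig] at this
  have hxpos : ∀ i, 0 < x i := fun i =>
    lt_of_le_of_ne (hx.1 i) fun h => by simpa [← h] using hpow i
  refine ⟨r, lt_of_le_of_ne hr fun h => ?_, x, hxpos, heig⟩
  obtain ⟨i⟩ := ‹Nonempty V›
  simpa [← h, hn.ne'] using hpow i

/-- The positive eigenvector of a primitive matrix dominates subinvariant vectors rigidly:
a nonnegative vector `h` with `r h ≤ B h` is a multiple of it. -/
theorem eq_smul_of_smul_le_mulVec [Nonempty V] [DecidableEq V] {B : Matrix V V ℝ}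
    (hB : B.IsPrimitive) {r : ℝ} (hr : 0 < r) {v : V → ℝ} (hv : ∀ i, 0 < v i)
    (hBv : B *ᵥ v = r • v) {h : V → ℝ} (hh : ∀ i, r * h i ≤ (B *ᵥ h) i) :
    ∃ c : ℝ, ∀ i, h i = c * v i := by
  obtain ⟨n, -, hP⟩ := hB.exists_pos_pow
  have hiter : ∀ m : ℕ, ∀ i, r ^ m * h i ≤ ((B ^ m) *ᵥ h) i := by
    intro m
    induction m with
    | zero => simp
    | succ m ih =>
      intro i
      rw [pow_succ' B m, ← mulVec_mulVec]
      calc r ^ (m + 1) * h i = r ^ m * (r * h i) := by ring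
        _ ≤ r ^ m * (B *ᵥ h) i := mul_le_mul_of_nonneg_left (hh i) (pow_nonneg hr.le m)
        _ = ∑ j, B i j * (r ^ m * h j) := by
          rw [mulVec, dotProduct, Finset.mul_sum]
          exact Finset.sum_congr rfl fun j _ => by ring
        _ ≤ ∑ j, B i j * ((B ^ m) *ᵥ h) j :=
          Finset.sum_le_sum fun j _ => mul_le_mul_of_nonneg_left (ih j) (hB.nonneg i j)
  -- With `c` the largest ratio `h / v`, the vector `c v - h ≥ 0` vanishes at `i₀`. If it were
  -- nonzero, `B ^ n` would make it positive at `i₀`, contradicting `r ^ n h ≤ B ^ n h` there.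
  obtain ⟨i₀, hi₀⟩ := Finite.exists_max fun i => h i / v i
  set c := h i₀ / v i₀ with hc
  have hw : ∀ i, 0 ≤ (c • v - h) i := fun i => by
    have := (div_le_iff₀ (hv i)).1 (hi₀ i)
    simpa using this
  have hw0 : c • v - h = 0 := by
    by_contra hne
    have h1 := mulVec_pos_of_pos hP hw hne i₀
    rw [mulVec_sub, mulVec_smul, pow_mulVec_eq_smul hBv] at h1
    simp only [Pi.sub_apply, Pi.smul_apply, smul_eq_mul] at h1
    have h2 := hiter n i₀
    have h3 : c * v i₀ = h i₀ := div_mul_cancel₀ _ (hv i₀).ne'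
    have h4 : c * (r ^ n * v i₀) = r ^ n * h i₀ := by rw [← h3]; ring
    linarith
  refine ⟨c, fun i => ?_⟩
  have := congrFun hw0 i
  simp only [Pi.sub_apply, Pi.smul_apply, smul_eq_mul, Pi.zero_apply] at this
  linarith

end PerronFrobenius

end LinearGIFS

namespace LinearGIFS

namespace OrderedGIFS

variable {d : ℕ} {V Γ : Type*} (G : OrderedGIFS d V Γ)

local notation "𝔼" => EuclideanSpace ℝ (Fin d)

theorem lex_asymm : ∀ {γ η : List Γ}, List.Lex G.prec γ η → ¬ List.Lex G.prec η γ
  | _, _, .nil, h => by cases h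
  | _, _, .rel h, .rel h' => G.prec_irrefl _ (G.prec_trans _ _ _ h h')
  | _, _, .rel h, .cons _ => G.prec_irrefl _ h
  | _, _, .cons _, .rel h' => G.prec_irrefl _ h'
  | _, _, .cons h, .cons h' => lex_asymm h h'

/-! ### Subdivision of the unit interval along the ordered walks. -/

section Addresses

variable [Fintype Γ]

open Classical in
/-- The left endpoint of the subinterval of `[0,1]` belonging to the edge `e`. -/
noncomputable def left (p : Γ → ℝ) (e : Γ) : ℝ := ∑ f with G.prec f e, p f

open Classical in
/-- `p` splits the unit interval among the edges leaving each vertex. -/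
structure IsSplitting (p : Γ → ℝ) : Prop where
  pos : ∀ e, 0 < p e
  sum_eq_one : ∀ i, ∑ e with G.src e = i, p e = 1

variable {G} {p : Γ → ℝ}

theorem IsSplitting.left_nonneg (hp : G.IsSplitting p) (e : Γ) : 0 ≤ G.left p e :=
  Finset.sum_nonneg fun f _ => (hp.pos f).le

theorem IsSplitting.left_add_le (hp : G.IsSplitting p) {e f : Γ} (h : G.prec e f) :
    G.left p e + p e ≤ G.left p f := by
  classical
  have hne : e ∉ Finset.univ.filter fun g => G.prec g e := by simp [G.prec_irrefl]
  rw [left, left, add_comm, ← Finset.sum_insert hne]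
  refine Finset.sum_le_sum_of_subset_of_nonneg (fun g hg => ?_) fun g _ _ => (hp.pos g).le
  rcases Finset.mem_insert.1 hg with rfl | hg
  · simpa using h
  · simpa using G.prec_trans _ _ _ (by simpa using hg) h

theorem IsSplitting.left_add_le_one (hp : G.IsSplitting p) (e : Γ) :
    G.left p e + p e ≤ 1 := by
  classical
  have hne : e ∉ Finset.univ.filter fun g => G.prec g e := by simp [G.prec_irrefl]
  rw [left, add_comm, ← Finset.sum_insert hne, ← hp.sum_eq_one (G.src e)]
  refine Finset.sum_le_sum_of_subset_of_nonneg (fun g hg => ?_) fun g _ _ => (hp.pos g).le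
  rcases Finset.mem_insert.1 hg with rfl | hg
  · simp
  · simpa using G.prec_src _ _ (by simpa using hg)

theorem IsSplitting.left_lt (hp : G.IsSplitting p) {e f : Γ} (h : G.prec e f) :
    G.left p e < G.left p f := by
  linarith [hp.left_add_le h, hp.pos e]

theorem IsSplitting.exists_left_eq_zero (hp : G.IsSplitting p) (i : V) :
    ∃ e, G.src e = i ∧ G.left p e = 0 := by
  classical
  have hne : (Finset.univ.filter fun e => G.src e = i).Nonempty := by
    by_contra h
    have := hp.sum_eq_one i
    rw [Finset.not_nonempty_iff_eq_empty.1 h] at this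
    simp at this
  obtain ⟨e, he, hmin⟩ := Finset.exists_min_image _ (G.left p) hne
  refine ⟨e, by simpa using he, Finset.sum_eq_zero fun f hf => ?_⟩
  have hf' : G.prec f e := by simpa using hf
  exact absurd (hmin f (by simpa [G.prec_src _ _ hf'] using he)) (hp.left_lt hf').not_ge

/-- The subintervals leave no gaps: the next edge after `e` starts where `e` ends, and the last edge
ends at one. -/
theorem IsSplitting.le_left_add (hp : G.IsSplitting p) {e : Γ} {x : ℝ} (hx : x ≤ 1)
    (h : ∀ f, G.prec e f → x < G.left p f) : x ≤ G.left p e + p e := by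
  classical
  have hne : e ∉ Finset.univ.filter fun g => G.prec g e := by simp [G.prec_irrefl]
  by_cases hs : ∃ f, G.prec e f
  · obtain ⟨f, hf, hmin⟩ := Finset.exists_min_image (Finset.univ.filter fun f => G.prec e f)
      (G.left p) (by simpa [Finset.filter_nonempty_iff] using hs)
    have hf' : G.prec e f := by simpa using hf
    refine (h f hf').le.trans ?_
    rw [left, left, add_comm, ← Finset.sum_insert hne]
    refine Finset.sum_le_sum_of_subset_of_nonneg (fun g hg => ?_) fun g _ _ => (hp.pos g).le
    have hg' : G.prec g f := by simpa using hg
    rcases G.prec_total g e ((G.prec_src _ _ hg').trans (G.prec_src _ _ hf').symm) with h1 | h1 | h1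
    · simp [h1]
    · simp [h1]
    · exact absurd (hmin g (by simpa using h1)) (hp.left_lt hg').not_ge
  · push Not at hs
    refine hx.trans ?_
    rw [left, add_comm, ← Finset.sum_insert hne, ← hp.sum_eq_one (G.src e)]
    refine Finset.sum_le_sum_of_subset_of_nonneg (fun g hg => ?_) fun g _ _ => (hp.pos g).le
    rcases G.prec_total g e (by simpa using hg) with h1 | h1 | h1
    · simp [h1]
    · simp [h1]
    · exact absurd h1 (hs g)

variable (G p) in
/-- `D i x` is the edge leaving `i` whose subinterval contains `x`. -/
structure IsDigitMap (D : V → ℝ → Γ) : Prop where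
  src_eq : ∀ i, ∀ x ∈ Icc (0 : ℝ) 1, G.src (D i x) = i
  left_le : ∀ i, ∀ x ∈ Icc (0 : ℝ) 1, G.left p (D i x) ≤ x
  lt_left : ∀ i, ∀ x ∈ Icc (0 : ℝ) 1, ∀ f, G.prec (D i x) f → x < G.left p f

theorem IsSplitting.exists_isDigitMap (hp : G.IsSplitting p) : ∃ D, G.IsDigitMap p D := by
  classical
  have key : ∀ i x, ∃ e, x ∈ Icc (0 : ℝ) 1 → G.src e = i ∧ G.left p e ≤ x ∧
      ∀ f, G.prec e f → x < G.left p f := by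
    intro i x
    obtain ⟨e₀, he₀, hl₀⟩ := hp.exists_left_eq_zero i
    by_cases hx : x ∈ Icc (0 : ℝ) 1
    -- The largest left endpoint not exceeding `x`: shared endpoints go to the later edge, and `x =
    -- 1` to the last one.
    · obtain ⟨e, he, hmax⟩ := Finset.exists_max_image
        (Finset.univ.filter fun e => G.src e = i ∧ G.left p e ≤ x) (G.left p)
        ⟨e₀, by simp [he₀, hl₀, hx.1]⟩
      simp only [Finset.mem_filter, Finset.mem_univ, true_and] at he hmax
      refine ⟨e, fun _ => ⟨he.1, he.2, fun f hf => ?_⟩⟩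
      by_contra hcon
      exact (hmax f ⟨(G.prec_src _ _ hf).symm.trans he.1, not_lt.1 hcon⟩).not_gt (hp.left_lt hf)
    · exact ⟨e₀, fun h => absurd h hx⟩
  choose D hD using key
  exact ⟨D, fun i x hx => (hD i x hx).1, fun i x hx => (hD i x hx).2.1,
    fun i x hx => (hD i x hx).2.2⟩

variable (G p) in
/-- The affine map sending the subinterval of `e` onto `[0,1]`. -/
noncomputable def rescale (e : Γ) (x : ℝ) : ℝ := (x - G.left p e) / p e

variable (G p) in
/-- The walk of length `k` from `i` whose subinterval contains `x`. -/
noncomputable def address (D : V → ℝ → Γ) : V → ℕ → ℝ → List Γ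
  | _, 0, _ => []
  | i, k + 1, x => D i x :: address D (G.tgt (D i x)) k (G.rescale p (D i x) x)

variable (G p) in
/-- The left endpoint of the subinterval of a walk. -/
noncomputable def walkLeft : List Γ → ℝ
  | [] => 0
  | e :: γ => G.left p e + p e * walkLeft γ

variable (p) in
/-- The length of the subinterval of a walk. -/
noncomputable def weight : List Γ → ℝ
  | [] => 1
  | e :: γ => p e * weight γ

variable {D : V → ℝ → Γ}

theorem IsSplitting.rescale_mem (hp : G.IsSplitting p) (hD : G.IsDigitMap p D) (i : V) {x : ℝ}
    (hx : x ∈ Icc (0 : ℝ) 1) : G.rescale p (D i x) x ∈ Icc (0 : ℝ) 1 := by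
  have h1 := hD.left_le i x hx
  have h2 := hp.le_left_add hx.2 (hD.lt_left i x hx)
  exact ⟨div_nonneg (sub_nonneg.2 h1) (hp.pos _).le,
    (div_le_one (hp.pos _)).2 (by linarith)⟩

theorem IsSplitting.weight_pos (hp : G.IsSplitting p) (γ : List Γ) : 0 < weight p γ := by
  induction γ with
  | nil => exact one_pos
  | cons e γ ih => exact mul_pos (hp.pos e) ih

theorem IsSplitting.address_mem_walks (hp : G.IsSplitting p) (hD : G.IsDigitMap p D) (i : V)
    (k : ℕ) {x : ℝ} (hx : x ∈ Icc (0 : ℝ) 1) : G.address p D i k x ∈ G.walks i k := by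
  induction k generalizing i x with
  | zero => exact ⟨trivial, rfl⟩
  | succ k ih =>
    obtain ⟨h1, h2⟩ := ih (G.tgt (D i x)) (hp.rescale_mem hD i hx)
    exact ⟨⟨hD.src_eq i x hx, h1⟩, by simp [address, h2]⟩

theorem IsSplitting.walkLeft_address_le (hp : G.IsSplitting p) (hD : G.IsDigitMap p D) (i : V)
    (k : ℕ) {x : ℝ} (hx : x ∈ Icc (0 : ℝ) 1) :
    G.walkLeft p (G.address p D i k x) ≤ x ∧
      x ≤ G.walkLeft p (G.address p D i k x) + weight p (G.address p D i k x) := by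
  induction k generalizing i x with
  | zero => simpa [address, walkLeft, weight] using hx
  | succ k ih =>
    obtain ⟨h1, h2⟩ := ih (G.tgt (D i x)) (hp.rescale_mem hD i hx)
    have hpe := hp.pos (D i x)
    have h1' := mul_le_mul_of_nonneg_left h1 hpe.le
    have h2' := mul_le_mul_of_nonneg_left h2 hpe.le
    have h3 : p (D i x) * G.rescale p (D i x) x = x - G.left p (D i x) :=
      mul_div_cancel₀ _ hpe.ne'
    simp only [address, walkLeft, weight]
    constructor <;> linarith

theorem IsSplitting.digit_eq (hp : G.IsSplitting p) (hD : G.IsDigitMap p D) {i : V} {x : ℝ}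
    (hx : x ∈ Icc (0 : ℝ) 1) {e : Γ} (he : G.src e = i) (h1 : G.left p e ≤ x)
    (h2 : x < G.left p e + p e) : D i x = e := by
  rcases G.prec_total (D i x) e ((hD.src_eq i x hx).trans he.symm) with h | h | h
  · exact absurd (hD.lt_left i x hx e h) h1.not_gt
  · exact h
  · linarith [hp.left_add_le h, hD.left_le i x hx]

/-- Rescaling by the first edge carries the interval of `e :: γ` to that of `γ`. The right endpoint
is excluded, since the address may already have moved to the next walk there. Disjointness of the
intervals of distinct walks of equal length follows. -/
theorem IsSplitting.address_eq (hp : G.IsSplitting p) (hD : G.IsDigitMap p D) {i : V} {k : ℕ}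
    {γ : List Γ} (hγ : γ ∈ G.walks i k) {x : ℝ} (h1 : G.walkLeft p γ ≤ x)
    (h2 : x < G.walkLeft p γ + weight p γ) : x ∈ Ico (0 : ℝ) 1 ∧ G.address p D i k x = γ := by
  induction γ generalizing i k x with
  | nil =>
    obtain ⟨-, rfl⟩ := hγ
    exact ⟨by simpa [walkLeft, weight] using And.intro h1 h2, rfl⟩
  | cons e γ ih =>
    obtain ⟨⟨he, hw⟩, rfl⟩ := hγ
    have hpe := hp.pos e
    have h3 : p e * G.rescale p e x = x - G.left p e := mul_div_cancel₀ _ hpe.ne'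
    simp only [walkLeft, weight] at h1 h2
    obtain ⟨hI, ha⟩ := ih (i := G.tgt e) (k := γ.length) ⟨hw, rfl⟩ (x := G.rescale p e x)
      (le_of_mul_le_mul_left (by linarith) hpe) (lt_of_mul_lt_mul_left (by linarith) hpe.le)
    have h4 : G.left p e ≤ x := by nlinarith [hI.1]
    have h5 : x < G.left p e + p e := by nlinarith [hI.2]
    have hx : x ∈ Ico (0 : ℝ) 1 :=
      ⟨(hp.left_nonneg e).trans h4, h5.trans_le (hp.left_add_le_one e)⟩
    have hde := hp.digit_eq hD (Ico_subset_Icc_self hx) he h4 h5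
    exact ⟨hx, by rw [List.length_cons, address, hde, ha]⟩

theorem IsSplitting.address_mono (hp : G.IsSplitting p) (hD : G.IsDigitMap p D) (i : V) (k : ℕ)
    {x y : ℝ} (hx : x ∈ Icc (0 : ℝ) 1) (hy : y ∈ Icc (0 : ℝ) 1) (hxy : x ≤ y) :
    G.address p D i k x = G.address p D i k y ∨
      List.Lex G.prec (G.address p D i k x) (G.address p D i k y) := by
  induction k generalizing i x y with
  | zero => exact Or.inl rfl
  | succ k ih =>
    rcases G.prec_total (D i x) (D i y) ((hD.src_eq i x hx).trans (hD.src_eq i y hy).symm)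
      with h | h | h
    · exact Or.inr (List.Lex.rel h)
    · have hr : G.rescale p (D i x) x ≤ G.rescale p (D i y) y := by
        rw [h, rescale, rescale]
        exact div_le_div_of_nonneg_right (by linarith) (hp.pos _).le
      rw [address, address]
      rcases ih (G.tgt (D i x)) (hp.rescale_mem hD i hx) (y := G.rescale p (D i y) y)
        (hp.rescale_mem hD i hy) hr with h' | h'
      · left
        rw [h', ← h]
      · right
        rw [← h] at h' ⊢
        exact List.Lex.cons h'
    · linarith [hD.lt_left i y hy _ h, hD.left_le i x hx]

/-- By monotonicity of addresses, the whole interval of a walk strictly in between would lie between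
`x` and `y`, which are too close for that. -/
theorem IsSplitting.adjacent_address (hp : G.IsSplitting p) (hD : G.IsDigitMap p D) {i : V}
    {k : ℕ} {x y : ℝ} (hx : x ∈ Icc (0 : ℝ) 1) (hy : y ∈ Icc (0 : ℝ) 1) (hxy : x ≤ y)
    (hne : G.address p D i k x ≠ G.address p D i k y)
    (hw : ∀ γ ∈ G.walks i k, y - x < weight p γ) :
    G.Adjacent i k (G.address p D i k x) (G.address p D i k y) := by
  refine ⟨hp.address_mem_walks hD i k hx, hp.address_mem_walks hD i k hy,
    (hp.address_mono hD i k hx hy hxy).resolve_left hne, ?_⟩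
  rintro ⟨θ, hθ, h1, h2⟩
  have hz : ∀ z, G.walkLeft p θ ≤ z → z < G.walkLeft p θ + weight p θ → x < z ∧ z < y := by
    intro z hz1 hz2
    obtain ⟨hz, ha⟩ := hp.address_eq hD hθ hz1 hz2
    have hz' := Ico_subset_Icc_self hz
    constructor
    · by_contra hcon
      rcases hp.address_mono hD i k hz' hx (not_lt.1 hcon) with h | h
      · rw [ha] at h
        rw [h] at h1
        exact G.lex_asymm h1 h1
      · rw [ha] at h
        exact G.lex_asymm h h1
    · by_contra hcon
      rcases hp.address_mono hD i k hy hz' (not_lt.1 hcon) with h | h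
      · rw [ha] at h
        rw [h] at h2
        exact G.lex_asymm h2 h2
      · rw [ha] at h
        exact G.lex_asymm h h2
  have h3 := hz _ le_rfl (lt_add_of_pos_right _ (hp.weight_pos θ))
  have h4 : G.walkLeft p θ + weight p θ ≤ y := by
    by_contra hcon
    exact (hz y h3.2.le (not_le.1 hcon)).2.false
  linarith [hw θ hθ]

end Addresses

/-! ### Cylinders and the coding map. -/

section Cylinders

variable {G} {E : V → Set (EuclideanSpace ℝ (Fin d))}

variable (G) in
-- With a single matrix, all walks of length `k` share the linear part `A⁻ᵏ`; their maps differ only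
-- by translations.
theorem walkMap_eq (γ : List Γ) :
    ∃ b : 𝔼, ∀ x, G.walkMap γ x = (G.A⁻¹ ^ γ.length).toEuclideanLin (x + b) := by
  induction γ with
  | nil => exact ⟨0, fun x => by simp [walkMap]⟩
  | cons e γ ih =>
    obtain ⟨b, hb⟩ := ih
    refine ⟨b + (G.A ^ γ.length).toEuclideanLin (G.digit e), fun x => ?_⟩
    have h := inv_pow_apply_pow_apply G.expanding γ.length (G.digit e)
    rw [List.length_cons, pow_succ', toEuclideanLin_mul_apply, ← add_assoc, map_add, h]
    simp [walkMap, map, hb]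

variable (G) in
theorem continuous_walkMap (γ : List Γ) : Continuous (G.walkMap γ) := by
  obtain ⟨b, hb⟩ := G.walkMap_eq γ
  rw [funext hb]
  exact (LinearMap.continuous_of_finiteDimensional _).comp (continuous_id.add continuous_const)

theorem IsInvariantFamily.isCompact_cylinder (hE : G.IsInvariantFamily E) (i : V) (γ : List Γ) :
    IsCompact (G.cylinder E i γ) :=
  (hE.isCompact _).image (G.continuous_walkMap γ)

theorem IsInvariantFamily.nonempty_cylinder (hE : G.IsInvariantFamily E) (i : V) (γ : List Γ) :
    (G.cylinder E i γ).Nonempty :=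
  (hE.nonempty _).image _

theorem cylinder_nil (i : V) : G.cylinder E i [] = E i := by
  simp [cylinder, walkMap, terminal]

theorem cylinder_cons (i : V) (e : Γ) (γ : List Γ) :
    G.cylinder E i (e :: γ) = G.map e '' G.cylinder E (G.tgt e) γ := by
  simp [cylinder, walkMap, terminal, image_image]

theorem IsInvariantFamily.map_image_subset (hE : G.IsInvariantFamily E) (e : Γ) :
    G.map e '' E (G.tgt e) ⊆ E (G.src e) := by
  rw [hE.eq_iUnion (G.src e)]
  exact subset_iUnion₂ (s := fun f (_ : G.src f = G.src e) => G.map f '' E (G.tgt f)) e rfl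

theorem IsInvariantFamily.cylinder_subset (hE : G.IsInvariantFamily E) {i : V} {γ : List Γ}
    (hγ : G.IsWalkFrom i γ) : G.cylinder E i γ ⊆ E i := by
  induction γ generalizing i with
  | nil => rw [cylinder_nil]
  | cons e γ ih =>
    obtain ⟨rfl, hw⟩ := hγ
    rw [cylinder_cons]
    exact (image_mono (ih hw)).trans (hE.map_image_subset e)

theorem IsInvariantFamily.exists_mem_cylinder (hE : G.IsInvariantFamily E) (k : ℕ) {i : V} {z : 𝔼}
    (hz : z ∈ E i) : ∃ γ ∈ G.walks i k, z ∈ G.cylinder E i γ := by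
  induction k generalizing i z with
  | zero => exact ⟨[], ⟨trivial, rfl⟩, by rwa [cylinder_nil]⟩
  | succ k ih =>
    rw [hE.eq_iUnion] at hz
    obtain ⟨e, rfl, w, hw, rfl⟩ := mem_iUnion₂.1 hz
    obtain ⟨γ, hγ, hwγ⟩ := ih hw
    exact ⟨e :: γ, ⟨⟨rfl, hγ.1⟩, by simp [hγ.2]⟩, by
      rw [cylinder_cons]
      exact mem_image_of_mem _ hwγ⟩

variable (G) in
theorem finite_walks [Finite Γ] (i : V) (k : ℕ) : (G.walks i k).Finite :=
  (List.finite_length_eq Γ k).subset fun _ h => h.2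

theorem IsInvariantFamily.cylinder_address_succ_subset [Fintype Γ] {p : Γ → ℝ} {D : V → ℝ → Γ}
    (hE : G.IsInvariantFamily E) (hp : G.IsSplitting p) (hD : G.IsDigitMap p D) (i : V) (k : ℕ)
    {x : ℝ} (hx : x ∈ Icc (0 : ℝ) 1) :
    G.cylinder E i (G.address p D i (k + 1) x) ⊆ G.cylinder E i (G.address p D i k x) := by
  induction k generalizing i x with
  | zero =>
    rw [show G.address p D i 0 x = [] from rfl, cylinder_nil]
    exact hE.cylinder_subset (hp.address_mem_walks hD i 1 hx).1
  | succ k ih =>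
    rw [address.eq_2 (k := k), address.eq_2, cylinder_cons, cylinder_cons]
    exact image_mono (ih _ (hp.rescale_mem hD i hx))

/-- The cylinders along an address are nested nonempty compact sets; a common point is chosen.
Outside `[0,1]` the value is an irrelevant default. -/
theorem IsInvariantFamily.exists_coding [Fintype Γ] {p : Γ → ℝ} {D : V → ℝ → Γ}
    (hE : G.IsInvariantFamily E) (hp : G.IsSplitting p) (hD : G.IsDigitMap p D) (i : V) :
    ∃ ψ : ℝ → 𝔼, ∀ x ∈ Icc (0 : ℝ) 1, ∀ k, ψ x ∈ G.cylinder E i (G.address p D i k x) := by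
  have key : ∀ x, ∃ z, x ∈ Icc (0 : ℝ) 1 → ∀ k, z ∈ G.cylinder E i (G.address p D i k x) := by
    intro x
    by_cases hx : x ∈ Icc (0 : ℝ) 1
    · obtain ⟨z, hz⟩ := IsCompact.nonempty_iInter_of_sequence_nonempty_isCompact_isClosed
        (fun k => G.cylinder E i (G.address p D i k x))
        (fun k => hE.cylinder_address_succ_subset hp hD i k hx)
        (fun k => hE.nonempty_cylinder i _) (hE.isCompact_cylinder i _)
        (fun k => (hE.isCompact_cylinder i _).isClosed)
      exact ⟨z, fun _ => mem_iInter.1 hz⟩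
    · exact ⟨0, fun h => absurd h hx⟩
  choose ψ hψ using key
  exact ⟨ψ, hψ⟩

end Cylinders

end OrderedGIFS

end LinearGIFS

namespace LinearGIFS

namespace OrderedGIFS

variable {d : ℕ} {V Γ : Type*} (G : OrderedGIFS d V Γ)

/-! ### Perron weights of edges and walks. -/

section Weights

variable [Fintype V] [DecidableEq V]

open Classical in
theorem transpose_assocMatrix_mulVec [Fintype Γ] (x : V → ℝ) (i : V) :
    (G.assocMatrix.transpose.mulVec x) i = ∑ e with G.src e = i, x (G.tgt e) := by
  have h : ∀ j, (Nat.card {e : Γ // G.src e = i ∧ G.tgt e = j} : ℝ) * x j =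
      ∑ e with G.src e = i ∧ G.tgt e = j, x (G.tgt e) := by
    intro j
    rw [Finset.sum_congr rfl fun e he => by rw [(Finset.mem_filter.1 he).2.2], Finset.sum_const,
      nsmul_eq_mul, Nat.card_eq_fintype_card, Fintype.card_subtype]
  simp only [Matrix.mulVec, dotProduct, Matrix.transpose_apply, assocMatrix, h]
  rw [← Finset.sum_fiberwise (Finset.univ.filter fun e => G.src e = i) G.tgt]
  simp only [Finset.filter_filter]

theorem transpose_assocMatrix_isPrimitive (h : G.assocMatrix.IsPrimitive) :
    G.assocMatrix.transpose.IsPrimitive := by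
  obtain ⟨n, hn, hP⟩ := h.exists_pos_pow
  refine ⟨fun i j => h.nonneg j i, n, hn, fun i j => ?_⟩
  rw [← Matrix.transpose_pow]
  exact hP j i

/-- The entries are natural numbers, so positive ones are at least one. This forces the Perron
eigenvalue above one. -/
theorem one_le_transpose_assocMatrix_pow {n : ℕ} {i j : V}
    (h : 0 < (G.assocMatrix.transpose ^ n) i j) : 1 ≤ (G.assocMatrix.transpose ^ n) i j := by
  have hcast : G.assocMatrix.transpose = (Nat.castRingHom ℝ).mapMatrix
      (Matrix.of fun i j : V => Nat.card {e : Γ // G.src e = i ∧ G.tgt e = j}) := rfl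
  rw [hcast, ← map_pow] at h ⊢
  simp only [RingHom.mapMatrix_apply, Matrix.map_apply, Nat.coe_castRingHom] at h ⊢
  exact_mod_cast Nat.succ_le_of_lt (Nat.cast_pos.1 h)

open Classical in
/-- The Perron eigenvector of the associated matrix, in terms of the edges. -/
theorem exists_perron_data [Fintype Γ] [Nonempty V] (hΓ : 1 < Fintype.card Γ)
    (hprim : G.assocMatrix.IsPrimitive) :
    ∃ ρ : ℝ, 0 < ρ ∧ ρ < 1 ∧ ∃ v : V → ℝ, (∀ i, 0 < v i) ∧
      (∀ i, ∑ e with G.src e = i, ρ * v (G.tgt e) = v i) ∧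
      ∀ h : V → ℝ, (∀ i, h i ≤ ∑ e with G.src e = i, ρ * h (G.tgt e)) →
        ∃ c : ℝ, ∀ i, h i = c * v i := by
  have hB := G.transpose_assocMatrix_isPrimitive hprim
  obtain ⟨r, hr, v, hv, hBv⟩ := exists_pos_eigenvector hB
  have heig : ∀ i, ∑ e with G.src e = i, v (G.tgt e) = r * v i := fun i => by
    rw [← G.transpose_assocMatrix_mulVec, hBv]
    rfl
  -- With one vertex, `r` is the number of edges. With two vertices `i ≠ j`, the entries of the
  -- positive power are at least one, so `r ^ n * v i ≥ v i + v j > v i`.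
  have hr1 : 1 < r := by
    rcases subsingleton_or_nontrivial V with hs | hs
    · obtain ⟨i⟩ := ‹Nonempty V›
      have h1 := heig i
      have h2 : ∑ e with G.src e = i, v (G.tgt e) = Fintype.card Γ * v i := by
        rw [Finset.filter_true_of_mem fun e _ => Subsingleton.elim _ _,
          Finset.sum_congr rfl fun e _ => by rw [Subsingleton.elim (G.tgt e) i]]
        simp
      rw [h2] at h1
      rw [← mul_right_cancel₀ (hv i).ne' h1]
      exact_mod_cast hΓ
    · obtain ⟨n, hn, hP⟩ := hB.exists_pos_pow
      obtain ⟨i, j, hij⟩ := exists_pair_ne V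
      have h1 := congrFun (pow_mulVec_eq_smul hBv n) i
      have h2 : v i + v j ≤ ((G.assocMatrix.transpose ^ n).mulVec v) i := by
        rw [← Finset.sum_pair hij]
        refine le_trans ?_ (Finset.sum_le_sum_of_subset_of_nonneg (Finset.subset_univ {i, j})
          fun k _ _ => mul_nonneg (hP i k).le (hv k).le)
        exact Finset.sum_le_sum fun k _ =>
          le_mul_of_one_le_left (hv k).le (G.one_le_transpose_assocMatrix_pow (hP i k))
      rw [h1, Pi.smul_apply, smul_eq_mul] at h2
      have h3 : 1 < r ^ n := by
        by_contra hcon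
        nlinarith [hv i, hv j]
      by_contra hcon
      exact h3.not_ge (pow_le_one₀ hr.le (not_lt.1 hcon))
  refine ⟨r⁻¹, inv_pos.2 hr, inv_lt_one_of_one_lt₀ hr1, v, hv, fun i => ?_, fun h hh => ?_⟩
  · rw [← Finset.mul_sum, heig, inv_mul_cancel_left₀ hr.ne']
  · refine eq_smul_of_smul_le_mulVec hB hr hv hBv fun i => ?_
    rw [G.transpose_assocMatrix_mulVec]
    have := hh i
    rw [← Finset.mul_sum] at this
    calc r * h i ≤ r * (r⁻¹ * ∑ e with G.src e = i, h (G.tgt e)) :=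
          mul_le_mul_of_nonneg_left this hr.le
      _ = _ := mul_inv_cancel_left₀ hr.ne' _

end Weights

section PerronWeights

variable {G} {ρ : ℝ} {v : V → ℝ}

variable (G ρ v) in
/-- The relative length of the subinterval of an edge, from the eigenvector `v`. -/
noncomputable def edgeWeight (e : Γ) : ℝ := ρ * v (G.tgt e) / v (G.src e)

open Classical in
theorem isSplitting_edgeWeight [Fintype Γ] (hρ : 0 < ρ) (hv : ∀ i, 0 < v i)
    (h : ∀ i, ∑ e with G.src e = i, ρ * v (G.tgt e) = v i) :
    G.IsSplitting (G.edgeWeight ρ v) where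
  pos e := div_pos (mul_pos hρ (hv _)) (hv _)
  sum_eq_one i := by
    rw [Finset.sum_congr rfl fun e he => by rw [edgeWeight, (Finset.mem_filter.1 he).2],
      ← Finset.sum_div, h, div_self (hv i).ne']

/-- The ratios of values of `v` telescope along the walk. -/
theorem weight_edgeWeight (hv : ∀ i, 0 < v i) {i : V} {k : ℕ} {γ : List Γ}
    (hγ : γ ∈ G.walks i k) :
    weight (G.edgeWeight ρ v) γ * v i = ρ ^ k * v (G.terminal i γ) := by
  induction γ generalizing i k with
  | nil =>
    obtain ⟨-, rfl⟩ := hγ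
    simp [weight, terminal]
  | cons e γ ih =>
    obtain ⟨⟨rfl, hw⟩, rfl⟩ := hγ
    have := ih ⟨hw, rfl⟩
    rw [weight, edgeWeight, terminal, List.length_cons, pow_succ', mul_assoc ρ, ← this]
    field_simp [(hv (G.src e)).ne']

theorem exists_weight_bounds [Finite V] [Nonempty V] (hρ : 0 < ρ) (hv : ∀ i, 0 < v i) :
    ∃ c₁ c₂ : ℝ, 0 < c₁ ∧ 0 < c₂ ∧ ∀ i k, ∀ γ ∈ G.walks i k,
      c₁ * ρ ^ k ≤ weight (G.edgeWeight ρ v) γ ∧ weight (G.edgeWeight ρ v) γ ≤ c₂ * ρ ^ k := by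
  obtain ⟨a, ha⟩ := Finite.exists_min v
  obtain ⟨b, hb⟩ := Finite.exists_max v
  refine ⟨v a / v b, v b / v a, div_pos (hv a) (hv b), div_pos (hv b) (hv a),
    fun i k γ hγ => ?_⟩
  have h : weight (G.edgeWeight ρ v) γ = v (G.terminal i γ) / v i * ρ ^ k := by
    rw [div_mul_eq_mul_div, eq_div_iff (hv i).ne', weight_edgeWeight hv hγ, mul_comm]
  rw [h]
  have hk := (pow_pos hρ k).le
  constructor
  · exact mul_le_mul_of_nonneg_right (div_le_div₀ (hv _).le (ha _) (hv i) (hb i)) hk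
  · exact mul_le_mul_of_nonneg_right (div_le_div₀ (hv b).le (hb _) (hv a) (ha i)) hk

end PerronWeights

end OrderedGIFS

end LinearGIFS

/-! ### Hölder bound from linearity, counting bound from the open set condition. -/

namespace LinearGIFS

theorem exists_card_le_of_separated {X : Type*} [PseudoMetricSpace X] {K : Set X}
    (hK : TotallyBounded K) {r : ℝ} (hr : 0 < r) :
    ∃ N : ℕ, ∀ {ι : Type*} (S : Finset ι) (c : ι → X), (∀ i ∈ S, c i ∈ K) →
      (∀ i ∈ S, ∀ j ∈ S, i ≠ j → r ≤ dist (c i) (c j)) → S.card ≤ N := by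
  obtain ⟨t, ht, hcov⟩ := Metric.totallyBounded_iff.1 hK (r / 2) (half_pos hr)
  refine ⟨ht.toFinset.card, fun S c hc hsep => ?_⟩
  have key : ∀ i, ∃ y, i ∈ S → y ∈ t ∧ dist (c i) y < r / 2 := by
    intro i
    by_cases hi : i ∈ S
    · obtain ⟨y, hy, hiy⟩ := mem_iUnion₂.1 (hcov (hc i hi))
      exact ⟨y, fun _ => ⟨hy, hiy⟩⟩
    · exact ⟨c i, fun h => absurd h hi⟩
  choose f hf using key
  refine Finset.card_le_card_of_injOn f (fun i hi => by simpa using (hf i hi).1) ?_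
  intro i hi j hj hij
  by_contra hne
  have h1 := (hf i hi).2
  have h2 := (hf j hj).2
  rw [← hij] at h2
  linarith [hsep i hi j hj hne, dist_triangle_right (c i) (c j) (f i)]

namespace OrderedGIFS

variable {d : ℕ} {V Γ : Type*} {G : OrderedGIFS d V Γ} {δ : ℝ}
  {φ : EuclideanSpace ℝ (Fin d) → ℝ} {E : V → Set (EuclideanSpace ℝ (Fin d))}

local notation "𝔼" => EuclideanSpace ℝ (Fin d)

theorem pseudoNorm_walkMap_sub (γ : List Γ) (x y : 𝔼) :
    pseudoNorm G.A φ (G.walkMap γ x - G.walkMap γ y) =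
      ratio G.A ^ γ.length * pseudoNorm G.A φ (x - y) := by
  obtain ⟨b, hb⟩ := G.walkMap_eq γ
  rw [hb, hb, ← map_sub, pseudoNorm_inv_pow_apply G.expanding, add_sub_add_right_eq_sub]

theorem IsInvariantFamily.exists_norm_bound [Finite V] (hE : G.IsInvariantFamily E) :
    ∃ R : ℝ, 0 ≤ R ∧ ∀ i, ∀ x ∈ E i, ‖x‖ ≤ R := by
  obtain ⟨R, hR⟩ := (isCompact_iUnion hE.isCompact).isBounded.exists_norm_le
  refine ⟨max R 0, le_max_right _ _, fun i x hx => (hR x (mem_iUnion.2 ⟨i, hx⟩)).trans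
    (le_max_left _ _)⟩

/-- Going through a common point, `x - y` is `A⁻ᵏ` applied to a vector of norm at most `4 R`. The
case `γ = η` bounds the diameter of a cylinder. -/
theorem IsInvariantFamily.exists_pseudoNorm_le [Finite V] (hE : G.IsInvariantFamily E)
    (hd : 0 < d) (hδ : δ < 1) (hφ : IsKernel δ φ) :
    ∃ C : ℝ, 0 < C ∧ ∀ i k, ∀ γ ∈ G.walks i k, ∀ η ∈ G.walks i k,
      (G.cylinder E i γ ∩ G.cylinder E i η).Nonempty →
      ∀ x ∈ G.cylinder E i γ, ∀ y ∈ G.cylinder E i η,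
        pseudoNorm G.A φ (x - y) ≤ C * ratio G.A ^ k := by
  obtain ⟨R, hR0, hR⟩ := hE.exists_norm_bound
  obtain ⟨C, hC⟩ := exists_summable_and_bound hd G.expanding hδ hφ (R + R + (R + R))
  refine ⟨max C 1, lt_max_of_lt_right one_pos, ?_⟩
  rintro i k γ hγ η hη ⟨_, ⟨a', ha', rfl⟩, ⟨b', hb', hab⟩⟩ _ ⟨a, ha, rfl⟩ _ ⟨b, hb, rfl⟩
  obtain ⟨s, hs⟩ := G.walkMap_eq γ
  obtain ⟨t, ht⟩ := G.walkMap_eq η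
  have h : G.walkMap γ a - G.walkMap η b =
      (G.A⁻¹ ^ k).toEuclideanLin ((a - a') + (b' - b)) := by
    have h1 : G.walkMap γ a - G.walkMap η b =
        (G.walkMap γ a - G.walkMap γ a') + (G.walkMap η b' - G.walkMap η b) := by
      rw [hab]
      abel
    rw [h1, hs, hs, ht, ht, hγ.2, hη.2, ← map_sub, ← map_sub, ← map_add,
      add_sub_add_right_eq_sub, add_sub_add_right_eq_sub]
  rw [h, pseudoNorm_inv_pow_apply G.expanding, mul_comm]
  refine mul_le_mul_of_nonneg_right ?_ (pow_pos (ratio_pos G.expanding) k).le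
  refine (hC _ ?_).2.trans (le_max_left _ _)
  refine (norm_add_le _ _).trans (add_le_add ?_ ?_)
  · exact (norm_sub_le _ _).trans (add_le_add (hR _ _ ha) (hR _ _ ha'))
  · exact (norm_sub_le _ _).trans (add_le_add (hR _ _ hb') (hR _ _ hb))

/-- Here linearity enters: points closer than every interval of level `k` have equal or adjacent
addresses. -/
theorem IsLinear.cylinder_address_inter_nonempty [Fintype Γ] {p : Γ → ℝ} {D : V → ℝ → Γ}
    (hlin : G.IsLinear E) (hE : G.IsInvariantFamily E) (hp : G.IsSplitting p)
    (hD : G.IsDigitMap p D) {i : V} {k : ℕ} {x y : ℝ} (hx : x ∈ Icc (0 : ℝ) 1)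
    (hy : y ∈ Icc (0 : ℝ) 1) (hw : ∀ γ ∈ G.walks i k, |x - y| < weight p γ) :
    (G.cylinder E i (G.address p D i k x) ∩ G.cylinder E i (G.address p D i k y)).Nonempty := by
  by_cases hne : G.address p D i k x = G.address p D i k y
  · rw [hne, inter_self]
    exact hE.nonempty_cylinder i _
  have hk : 1 ≤ k := by
    rcases Nat.eq_zero_or_pos k with rfl | hk
    · exact absurd rfl hne
    · exact hk
  rcases le_total x y with hxy | hxy
  · refine hlin i k hk _ _ (hp.adjacent_address hD hx hy hxy hne fun γ hγ => ?_)
    rw [← abs_of_nonneg (sub_nonneg.2 hxy), abs_sub_comm]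
    exact hw γ hγ
  · rw [inter_comm]
    refine hlin i k hk _ _ (hp.adjacent_address hD hy hx hxy (Ne.symm hne) fun γ hγ => ?_)
    rw [← abs_of_nonneg (sub_nonneg.2 hxy)]
    exact hw γ hγ

theorem exists_holder_bound [Fintype Γ] [Finite V] {p : Γ → ℝ} {D : V → ℝ → Γ} {ρ c₁ α : ℝ}
    (hd : 0 < d) (hδ : δ < 1) (hφ : IsKernel δ φ) (hE : G.IsInvariantFamily E)
    (hlin : G.IsLinear E) (hp : G.IsSplitting p) (hD : G.IsDigitMap p D) (hρ : 0 < ρ)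
    (hρ1 : ρ < 1) (hα : 0 < α) (hκ : ratio G.A ^ α = ρ) (hc₁ : 0 < c₁) {i : V}
    (hw : ∀ k, ∀ γ ∈ G.walks i k, c₁ * ρ ^ k ≤ weight p γ) {ψ : ℝ → 𝔼}
    (hψ : ∀ x ∈ Icc (0 : ℝ) 1, ∀ k, ψ x ∈ G.cylinder E i (G.address p D i k x)) :
    ∃ c : ℝ, 0 < c ∧ ∀ x ∈ Icc (0 : ℝ) 1, ∀ y ∈ Icc (0 : ℝ) 1,
      pseudoNorm G.A φ (ψ x - ψ y) ≤ c * |x - y| ^ (1 / α) := by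
  obtain ⟨C, hC0, hC⟩ := hE.exists_pseudoNorm_le hd hδ hφ
  have hκ0 := ratio_pos G.expanding
  have hα' : 0 < 1 / α := one_div_pos.2 hα
  have hκ' : ∀ k : ℕ, ratio G.A ^ k = (ρ ^ k) ^ (1 / α) := fun k => by
    rw [← hκ, ← Real.rpow_natCast (ratio G.A ^ α), ← Real.rpow_mul hκ0.le, ← Real.rpow_mul hκ0.le,
      show α * k * (1 / α) = k by field_simp, Real.rpow_natCast]
  -- The factor 2 turns the non-strict choice of `k` into `t < c₁ * ρ ^ k`; the inverse ratio pays
  -- for passing from level `k + 1` to level `k`.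
  refine ⟨C * (ratio G.A)⁻¹ * (2 / c₁) ^ (1 / α), by positivity, fun x hx y hy => ?_⟩
  set t := |x - y| with ht
  rcases eq_or_ne x y with rfl | hxy
  · rw [sub_self, pseudoNorm_zero hd G.expanding]
    positivity
  have ht0 : 0 < t := abs_pos.2 (sub_ne_zero.2 hxy)
  suffices h : ∃ k : ℕ, ρ ^ (k + 1) ≤ 2 / c₁ * t ∧
      pseudoNorm G.A φ (ψ x - ψ y) ≤ C * ratio G.A ^ k by
    obtain ⟨k, hk1, hk2⟩ := h
    refine hk2.trans ?_
    have h1 : ratio G.A ^ (k + 1) ≤ (2 / c₁) ^ (1 / α) * t ^ (1 / α) := by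
      rw [hκ', ← Real.mul_rpow (by positivity) ht0.le]
      exact Real.rpow_le_rpow (by positivity) hk1 hα'.le
    calc C * ratio G.A ^ k = C * (ratio G.A)⁻¹ * ratio G.A ^ (k + 1) := by
          rw [pow_succ]; field_simp
      _ ≤ C * (ratio G.A)⁻¹ * ((2 / c₁) ^ (1 / α) * t ^ (1 / α)) :=
          mul_le_mul_of_nonneg_left h1 (by positivity)
      _ = _ := by ring
  rcases le_or_gt (2 / c₁ * t) 1 with hle | hgt
  · obtain ⟨k, hk1, hk2⟩ := exists_nat_pow_near_of_lt_one (by positivity) hle hρ hρ1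
    refine ⟨k, hk1.le, hC i k _ (hp.address_mem_walks hD i k hx) _
      (hp.address_mem_walks hD i k hy) ?_ _ (hψ x hx k) _ (hψ y hy k)⟩
    refine hlin.cylinder_address_inter_nonempty hE hp hD hx hy fun γ hγ => ?_
    refine lt_of_lt_of_le ?_ (hw k γ hγ)
    rw [div_mul_eq_mul_div, div_le_iff₀ hc₁] at hk2
    linarith
  · refine ⟨0, ?_, hC i 0 _ (hp.address_mem_walks hD i 0 hx) _ (hp.address_mem_walks hD i 0 hy)
      ?_ _ (hψ x hx 0) _ (hψ y hy 0)⟩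
    · rw [zero_add, pow_one]
      exact (hρ1.trans hgt).le
    · rw [show G.address p D i 0 x = G.address p D i 0 y from rfl, inter_self]
      exact hE.nonempty_cylinder i _

theorem continuousOn_of_pseudoNorm_holder {A : Matrix (Fin d) (Fin d) ℝ} (hA : IsExpanding A)
    (hd : 0 < d) (hδ : δ < 1) (hφ : IsKernel δ φ)
    {ψ : ℝ → 𝔼} {c s : ℝ} (hc : 0 < c) (hs : 0 < s) {I : Set ℝ}
    (hψ : ∀ x ∈ I, ∀ y ∈ I, pseudoNorm A φ (ψ x - ψ y) ≤ c * |x - y| ^ s) :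
    ContinuousOn ψ I := by
  rw [Metric.continuousOn_iff]
  intro y hy r hr
  obtain ⟨ε, hε, hεb⟩ := exists_pseudoNorm_le_imp_norm_lt hd hA hδ hφ hr
  refine ⟨(ε / c) ^ (1 / s), Real.rpow_pos_of_pos (div_pos hε hc) _, fun x hx hxy => ?_⟩
  rw [dist_eq_norm]
  refine hεb _ ((hψ x hx y hy).trans ?_)
  rw [Real.dist_eq] at hxy
  have := Real.rpow_le_rpow (abs_nonneg _) hxy.le hs.le
  rw [← Real.rpow_mul (div_pos hε hc).le, one_div_mul_cancel hs.ne', Real.rpow_one,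
    le_div_iff₀ hc] at this
  linarith

/-- Cylinders are taken of the open sets `U` instead of `E`. Strip the common initial edges, which
act injectively; at the first difference the open set condition applies. -/
theorem disjoint_walkMap_image {U : V → Set 𝔼}
    (hsub : ∀ e : Γ, G.map e '' U (G.tgt e) ⊆ U (G.src e))
    (hdisj : ∀ e f : Γ, e ≠ f → G.src e = G.src f →
      Disjoint (G.map e '' U (G.tgt e)) (G.map f '' U (G.tgt f)))
    {i : V} {k : ℕ} {γ η : List Γ} (hγ : γ ∈ G.walks i k) (hη : η ∈ G.walks i k) (hne : γ ≠ η) :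
    Disjoint (G.cylinder U i γ) (G.cylinder U i η) := by
  have hsub' : ∀ {i : V} {γ : List Γ}, G.IsWalkFrom i γ → G.cylinder U i γ ⊆ U i := by
    intro i γ hγ
    induction γ generalizing i with
    | nil => rw [cylinder_nil]
    | cons e γ ih =>
      obtain ⟨rfl, hw⟩ := hγ
      rw [cylinder_cons]
      exact (image_mono (ih hw)).trans (hsub e)
  have hinj : ∀ e, Function.Injective (G.map e) := by
    intro e x y hxy
    have h : ∀ z : 𝔼, G.A.toEuclideanLin (G.map e z) = z + G.digit e := fun z => by
      rw [map, ← toEuclideanLin_mul_apply, Matrix.mul_nonsing_inv _ G.expanding.isUnit_det,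
        toEuclideanLin_one_apply]
    have := h x
    rw [hxy, h y] at this
    exact (add_right_cancel this).symm
  induction γ generalizing i k η with
  | nil =>
    obtain ⟨-, rfl⟩ := hγ
    exact absurd (List.length_eq_zero_iff.1 hη.2).symm hne
  | cons e γ ih =>
    obtain ⟨⟨rfl, hw⟩, rfl⟩ := hγ
    cases η with
    | nil => exact absurd hη.2 (by simp)
    | cons f η =>
      obtain ⟨⟨hf, hw'⟩, hlen⟩ := hη
      rw [cylinder_cons, cylinder_cons]
      by_cases hef : e = f
      · subst hef
        refine disjoint_image_of_injective (hinj e) (ih (k := γ.length) ⟨hw, rfl⟩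
          ⟨hw', by simpa using hlen⟩ fun h => hne (by rw [h]))
      · exact (hdisj e f hef hf.symm).mono (image_mono (hsub' hw)) (image_mono (hsub' hw'))

/-- By the open set condition, a set of pseudo-norm diameter at most `q^{-k/d}` meets a bounded
number of cylinders of level `k`. -/
theorem exists_card_cylinders_le [Finite V] (hd : 0 < d) (hδ : δ < 1)
    (hφ : IsKernel δ φ) (hE : G.IsInvariantFamily E) (hosc : G.OpenSetCondition) :
    ∃ N : ℕ, ∀ i k, ∀ T : Set 𝔼, omegaDiam G.A φ T ≤ ENNReal.ofReal (ratio G.A ^ k) →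
      ∀ S : Finset (List Γ), (∀ γ ∈ S, γ ∈ G.walks i k ∧ (G.cylinder E i γ ∩ T).Nonempty) →
        S.card ≤ N := by
  obtain ⟨U, hU, hsub, hdisj⟩ := hosc
  choose u hu using fun i => (hU i).2
  have hr : ∃ r : ℝ, 0 < r ∧ ∀ i, Metric.ball (u i) r ⊆ U i := by
    have key : ∀ i, ∃ r : ℝ, 0 < r ∧ Metric.ball (u i) r ⊆ U i := fun i =>
      Metric.isOpen_iff.1 (hU i).1 _ (hu i)
    choose r hr0 hr using key
    rcases isEmpty_or_nonempty V with hV | hV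
    · exact ⟨1, one_pos, fun i => hV.elim i⟩
    · obtain ⟨i₀, hi₀⟩ := Finite.exists_min r
      exact ⟨r i₀, hr0 i₀, fun i => (Metric.ball_subset_ball (hi₀ i)).trans (hr i)⟩
  obtain ⟨r, hr0, hr⟩ := hr
  obtain ⟨Q, hQ⟩ := (Set.finite_range fun i => ‖u i‖).bddAbove
  obtain ⟨R, hR0, hR⟩ := hE.exists_norm_bound
  obtain ⟨R₁, hR₁0, hR₁⟩ := exists_norm_bound_of_pseudoNorm_le_one hd G.expanding hδ hφ
  obtain ⟨N, hN⟩ := exists_card_le_of_separated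
    (isCompact_closedBall (0 : 𝔼) (R₁ + (R + R) + (Q + Q))).totallyBounded hr0
  refine ⟨N, fun i k T hT S hS => ?_⟩
  rcases S.eq_empty_or_nonempty with rfl | ⟨γ₀, hγ₀⟩
  · simp
  choose b hb using G.walkMap_eq
  have hκ := pow_pos (ratio_pos G.expanding) k
  -- After blowing up by `A ^ k`, cylinders become translates by `b γ`. The marked points `u + b γ`,
  -- taken relative to one of them, stay in a fixed ball because all cylinders meet `T`. They are
  -- `r`-separated, since otherwise two of the disjoint open cylinders would share a point.
  refine hN S (fun γ => (u (G.terminal i γ) + b γ) - (u (G.terminal i γ₀) + b γ₀)) ?_ ?_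
  · intro γ hγ
    obtain ⟨⟨hw, hl⟩, _, ⟨x, hx, rfl⟩, hxT⟩ := hS γ hγ
    obtain ⟨⟨hw₀, hl₀⟩, _, ⟨y, hy, rfl⟩, hyT⟩ := hS γ₀ hγ₀
    have h1 := (ofReal_pseudoNorm_le_omegaDiam (A := G.A) (φ := φ) hxT hyT).trans hT
    rw [ENNReal.ofReal_le_ofReal_iff hκ.le, hb, hb, hl, hl₀, ← map_sub,
      pseudoNorm_inv_pow_apply G.expanding, mul_le_iff_le_one_right hκ] at h1
    have h2 := hR₁ _ h1
    rw [mem_closedBall_zero_iff]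
    have h3 : (u (G.terminal i γ) + b γ) - (u (G.terminal i γ₀) + b γ₀) =
        ((x + b γ) - (y + b γ₀)) + (y - x) + (u (G.terminal i γ) - u (G.terminal i γ₀)) := by
      abel
    rw [h3]
    refine (norm_add₃_le ..).trans (add_le_add (add_le_add h2 ?_) ?_)
    · exact (norm_sub_le _ _).trans (add_le_add (hR _ _ hy) (hR _ _ hx))
    · exact (norm_sub_le _ _).trans (add_le_add (hQ ⟨_, rfl⟩) (hQ ⟨_, rfl⟩))
  · intro γ hγ η hη hne
    by_contra hcon
    rw [not_le, dist_sub_right] at hcon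
    have hγw := (hS γ hγ).1
    have hηw := (hS η hη).1
    refine Set.disjoint_left.1 (disjoint_walkMap_image hsub hdisj hγw hηw hne)
      (show G.walkMap η (u (G.terminal i η)) ∈ _ from ?_) ⟨_, hu _, rfl⟩
    refine ⟨u (G.terminal i η) + b η - b γ, hr _ ?_, ?_⟩
    · rw [Metric.mem_ball, dist_comm, dist_eq_norm]
      rw [dist_eq_norm] at hcon
      rwa [sub_sub_eq_add_sub]
    · rw [hb, hb, hγw.2, hηw.2, sub_add_cancel]

/-- The preimage of `T` is covered by the intervals of the boundedly many walks whose cylinders meet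
`T`, at the level `k` matching the diameter of `T`. This is the hypothesis of the mass distribution
principle. -/
theorem exists_volume_preimage_le [Fintype Γ] [Finite V] {p : Γ → ℝ} {D : V → ℝ → Γ}
    {ρ c₂ α : ℝ} (hd : 0 < d) (hδ : δ < 1) (hφ : IsKernel δ φ) (hE : G.IsInvariantFamily E)
    (hosc : G.OpenSetCondition) (hp : G.IsSplitting p) (hD : G.IsDigitMap p D) (hρ : 0 < ρ)
    (hρ1 : ρ < 1) (hα : 0 < α) (hκ : ratio G.A ^ α = ρ) (hc₂ : 0 < c₂) {i : V}
    (hw : ∀ k, ∀ γ ∈ G.walks i k, weight p γ ≤ c₂ * ρ ^ k) {ψ : ℝ → 𝔼}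
    (hψ : ∀ x ∈ Icc (0 : ℝ) 1, ∀ k, ψ x ∈ G.cylinder E i (G.address p D i k x)) :
    ∃ C : ℝ, 0 < C ∧ ∀ T : Set 𝔼, omegaDiam G.A φ T ≤ 1 →
      volume (ψ ⁻¹' T ∩ Icc 0 1) ≤ ENNReal.ofReal C * omegaDiam G.A φ T ^ α := by
  classical
  obtain ⟨N, hN⟩ := exists_card_cylinders_le hd hδ hφ hE hosc
  have hκ0 := ratio_pos G.expanding
  have hκ1 := ratio_lt_one hd G.expanding
  have key : ∀ k, ∀ T : Set 𝔼, omegaDiam G.A φ T ≤ ENNReal.ofReal (ratio G.A ^ k) →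
      volume (ψ ⁻¹' T ∩ Icc 0 1) ≤ ENNReal.ofReal ((N + 1) * c₂ * ρ ^ k) := by
    intro k T hT
    set S := (G.finite_walks i k).toFinset.filter fun γ => (G.cylinder E i γ ∩ T).Nonempty with hS
    have hmem : ∀ γ ∈ S, γ ∈ G.walks i k ∧ (G.cylinder E i γ ∩ T).Nonempty := fun γ hγ => by
      simpa [hS] using hγ
    have hcov : ψ ⁻¹' T ∩ Icc 0 1 ⊆
        ⋃ γ ∈ S, Icc (G.walkLeft p γ) (G.walkLeft p γ + weight p γ) := by
      rintro x ⟨hxT, hx⟩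
      refine mem_iUnion₂.2 ⟨G.address p D i k x, ?_, hp.walkLeft_address_le hD i k hx⟩
      rw [hS, Finset.mem_filter, Set.Finite.mem_toFinset]
      exact ⟨hp.address_mem_walks hD i k hx, ψ x, hψ x hx k, hxT⟩
    calc volume (ψ ⁻¹' T ∩ Icc 0 1)
        ≤ ∑ γ ∈ S, volume (Icc (G.walkLeft p γ) (G.walkLeft p γ + weight p γ)) :=
          (measure_mono hcov).trans (measure_biUnion_finset_le _ _)
      _ ≤ ∑ γ ∈ S, ENNReal.ofReal (c₂ * ρ ^ k) := by
          refine Finset.sum_le_sum fun γ hγ => ?_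
          rw [Real.volume_Icc, add_sub_cancel_left]
          exact ENNReal.ofReal_le_ofReal (hw k γ (hmem γ hγ).1)
      _ = ENNReal.ofReal (S.card * (c₂ * ρ ^ k)) := by
          rw [Finset.sum_const, nsmul_eq_mul, ENNReal.ofReal_mul (Nat.cast_nonneg _),
            ENNReal.ofReal_natCast]
      _ ≤ _ := by
          refine ENNReal.ofReal_le_ofReal ?_
          rw [mul_assoc]
          have : (S.card : ℝ) ≤ N := by exact_mod_cast hN i k T hT S hmem
          exact mul_le_mul_of_nonneg_right (by linarith) (by positivity)
  -- `N + 1` keeps the constant positive. For diameter zero the bound holds at every level, so `k →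
  -- ∞`.
  refine ⟨(N + 1) * c₂ * ρ⁻¹, by positivity, fun T hT => ?_⟩
  rcases eq_or_ne (omegaDiam G.A φ T) 0 with h0 | h0
  · have hlim : Filter.Tendsto (fun k : ℕ => ENNReal.ofReal ((N + 1) * c₂ * ρ ^ k)) Filter.atTop
        (nhds 0) := by
      rw [← ENNReal.ofReal_zero]
      refine ENNReal.tendsto_ofReal ?_
      simpa using (tendsto_pow_atTop_nhds_zero_of_lt_one hρ.le hρ1).const_mul ((N + 1) * c₂)
    have : volume (ψ ⁻¹' T ∩ Icc 0 1) ≤ 0 :=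
      ge_of_tendsto' hlim fun k => key k T (by rw [h0]; exact zero_le)
    exact this.trans zero_le
  · have htop : omegaDiam G.A φ T ≠ ⊤ := (hT.trans_lt ENNReal.one_lt_top).ne
    set D' := (omegaDiam G.A φ T).toReal with hD'
    have hD'0 : 0 < D' := ENNReal.toReal_pos h0 htop
    have hTD : omegaDiam G.A φ T = ENNReal.ofReal D' := (ENNReal.ofReal_toReal htop).symm
    have hD'1 : D' ≤ 1 := by
      rw [hTD] at hT
      simpa using hT
    obtain ⟨k, hk1, hk2⟩ := exists_nat_pow_near_of_lt_one hD'0 hD'1 hκ0 hκ1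
    refine (key k T (by rw [hTD]; exact ENNReal.ofReal_le_ofReal hk2)).trans ?_
    rw [hTD, ENNReal.ofReal_rpow_of_pos hD'0, ← ENNReal.ofReal_mul (by positivity)]
    refine ENNReal.ofReal_le_ofReal ?_
    have h1 : ρ ^ (k + 1) ≤ D' ^ α := by
      rw [← hκ, ← Real.rpow_natCast (ratio G.A ^ α), ← Real.rpow_mul hκ0.le, mul_comm α,
        Real.rpow_mul hκ0.le, Real.rpow_natCast]
      exact Real.rpow_le_rpow (pow_pos hκ0 _).le hk1.le hα.le
    calc (N + 1) * c₂ * ρ ^ k = (N + 1) * c₂ * ρ⁻¹ * ρ ^ (k + 1) := by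
          rw [pow_succ]; field_simp
      _ ≤ _ := mul_le_mul_of_nonneg_left h1 (by positivity)

end OrderedGIFS

end LinearGIFS

/-! ### The coding map as a measure isomorphism. -/

namespace LinearGIFS

namespace OrderedGIFS

variable {d : ℕ} {V Γ : Type*} {G : OrderedGIFS d V Γ} {δ : ℝ}
  {φ : EuclideanSpace ℝ (Fin d) → ℝ} {E : V → Set (EuclideanSpace ℝ (Fin d))}

local notation "𝔼" => EuclideanSpace ℝ (Fin d)

theorem IsInvariantFamily.exists_cylinder_dist_lt [Finite V] (hE : G.IsInvariantFamily E)
    (hd : 0 < d) (hδ : δ < 1) (hφ : IsKernel δ φ) {r : ℝ} (hr : 0 < r) :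
    ∃ k, ∀ i, ∀ γ ∈ G.walks i k, ∀ x ∈ G.cylinder E i γ, ∀ y ∈ G.cylinder E i γ, dist x y < r := by
  obtain ⟨C, hC0, hC⟩ := hE.exists_pseudoNorm_le hd hδ hφ
  obtain ⟨ε, hε, hεb⟩ := exists_pseudoNorm_le_imp_norm_lt hd G.expanding hδ hφ hr
  obtain ⟨k, hk⟩ := exists_pow_lt_of_lt_one (div_pos hε hC0) (ratio_lt_one hd G.expanding)
  refine ⟨k, fun i γ hγ x hx y hy => ?_⟩
  rw [dist_eq_norm]
  refine hεb _ ((hC i k γ hγ γ hγ (by rw [inter_self]; exact hE.nonempty_cylinder i γ) x hx y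
    hy).trans ?_)
  rw [lt_div_iff₀ hC0] at hk
  linarith

section Coding

variable [Fintype Γ] {p : Γ → ℝ} {D : V → ℝ → Γ} {i : V} {ψ : ℝ → EuclideanSpace ℝ (Fin d)}

/-- The image is compact, and it meets every cylinder because the left endpoint of an interval has
the corresponding address. Since cylinders shrink, it is dense in `E i`. -/
theorem image_coding_eq [Finite V] (hd : 0 < d) (hδ : δ < 1) (hφ : IsKernel δ φ)
    (hE : G.IsInvariantFamily E) (hp : G.IsSplitting p) (hD : G.IsDigitMap p D)
    (hψ : ∀ x ∈ Icc (0 : ℝ) 1, ∀ k, ψ x ∈ G.cylinder E i (G.address p D i k x))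
    (hcont : ContinuousOn ψ (Icc 0 1)) : ψ '' Icc 0 1 = E i := by
  apply Subset.antisymm
  · rintro _ ⟨x, hx, rfl⟩
    have := hψ x hx 0
    rwa [address, cylinder_nil] at this
  · intro z hz
    have hcl : IsClosed (ψ '' Icc 0 1) := (isCompact_Icc.image_of_continuousOn hcont).isClosed
    rw [← hcl.closure_eq, Metric.mem_closure_iff]
    intro r hr
    obtain ⟨k, hk⟩ := hE.exists_cylinder_dist_lt hd hδ hφ hr
    obtain ⟨γ, hγ, hzγ⟩ := hE.exists_mem_cylinder k hz
    obtain ⟨hx, ha⟩ := hp.address_eq hD hγ le_rfl (lt_add_of_pos_right _ (hp.weight_pos γ))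
    have hx' := Ico_subset_Icc_self hx
    refine ⟨_, mem_image_of_mem ψ hx', hk i γ hγ z hzγ _ ?_⟩
    have := hψ _ hx' k
    rwa [ha] at this

theorem IsSplitting.Ico_subset_preimage_cylinder (hp : G.IsSplitting p) (hD : G.IsDigitMap p D)
    (hψ : ∀ x ∈ Icc (0 : ℝ) 1, ∀ k, ψ x ∈ G.cylinder E i (G.address p D i k x)) {k : ℕ}
    {γ : List Γ} (hγ : γ ∈ G.walks i k) :
    Ico (G.walkLeft p γ) (G.walkLeft p γ + weight p γ) ⊆
      ψ ⁻¹' G.cylinder E i γ ∩ Icc 0 1 := by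
  rintro x ⟨hx1, hx2⟩
  obtain ⟨hx, ha⟩ := hp.address_eq hD hγ hx1 hx2
  have hx' := Ico_subset_Icc_self hx
  refine ⟨?_, hx'⟩
  have := hψ x hx' k
  rwa [ha] at this

/-- Cover `K` by the cylinders of diameter below `r` that meet it. Their intervals are disjoint and
are mapped into the `r`-neighbourhood of `K`, so their total weight is bounded by the volume on the
right. -/
theorem omegaHausdorff_le_mul_volume_cthickening [Finite V] (hd : 0 < d) (hδ : δ < 1)
    (hφ : IsKernel δ φ) (hE : G.IsInvariantFamily E) (hp : G.IsSplitting p)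
    (hD : G.IsDigitMap p D)
    (hψ : ∀ x ∈ Icc (0 : ℝ) 1, ∀ k, ψ x ∈ G.cylinder E i (G.address p D i k x)) {s : ℝ}
    (hcyl : ∀ k, ∀ γ ∈ G.walks i k, omegaHausdorff G.A φ s (G.cylinder E i γ) ≤
      ENNReal.ofReal (weight p γ) * omegaHausdorff G.A φ s (E i)) {K : Set 𝔼} (hK : K ⊆ E i)
    {r : ℝ} (hr : 0 < r) :
    omegaHausdorff G.A φ s K ≤
      omegaHausdorff G.A φ s (E i) * volume (ψ ⁻¹' Metric.cthickening r K ∩ Icc 0 1) := by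
  classical
  obtain ⟨k, hk⟩ := hE.exists_cylinder_dist_lt hd hδ hφ hr
  set S := (G.finite_walks i k).toFinset.filter fun γ => (G.cylinder E i γ ∩ K).Nonempty with hS
  have hmem : ∀ γ ∈ S, γ ∈ G.walks i k ∧ (G.cylinder E i γ ∩ K).Nonempty := fun γ hγ => by
    simpa [hS] using hγ
  have hcov : K ⊆ ⋃ γ ∈ S, G.cylinder E i γ := by
    intro z hz
    obtain ⟨γ, hγ, hzγ⟩ := hE.exists_mem_cylinder k (hK hz)
    refine mem_iUnion₂.2 ⟨γ, ?_, hzγ⟩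
    rw [hS, Finset.mem_filter, Set.Finite.mem_toFinset]
    exact ⟨hγ, z, hzγ, hz⟩
  have hsub : (⋃ γ ∈ S, Ico (G.walkLeft p γ) (G.walkLeft p γ + weight p γ)) ⊆
      ψ ⁻¹' Metric.cthickening r K ∩ Icc 0 1 := by
    refine iUnion₂_subset fun γ hγ x hx => ?_
    obtain ⟨hγw, y, hyγ, hyK⟩ := hmem γ hγ
    obtain ⟨hxγ, hxI⟩ := hp.Ico_subset_preimage_cylinder hD hψ hγw hx
    exact ⟨Metric.mem_cthickening_of_dist_le _ y r K hyK (hk i γ hγw _ hxγ y hyγ).le, hxI⟩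
  have hdisj : (S : Set (List Γ)).PairwiseDisjoint
      fun γ => Ico (G.walkLeft p γ) (G.walkLeft p γ + weight p γ) := by
    intro γ hγ η hη hne
    refine Set.disjoint_left.2 fun x hx hy => hne ?_
    rw [← (hp.address_eq hD (hmem γ hγ).1 hx.1 hx.2).2,
      ← (hp.address_eq hD (hmem η hη).1 hy.1 hy.2).2]
  calc omegaHausdorff G.A φ s K
      ≤ ∑ γ ∈ S, omegaHausdorff G.A φ s (G.cylinder E i γ) :=
        (omegaHausdorff_mono s hcov).trans (omegaHausdorff_biUnion_finset_le s S _)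
    _ ≤ ∑ γ ∈ S, ENNReal.ofReal (weight p γ) * omegaHausdorff G.A φ s (E i) :=
        Finset.sum_le_sum fun γ hγ => hcyl k γ (hmem γ hγ).1
    _ = omegaHausdorff G.A φ s (E i) *
        volume (⋃ γ ∈ S, Ico (G.walkLeft p γ) (G.walkLeft p γ + weight p γ)) := by
        rw [measure_biUnion_finset hdisj fun _ _ => measurableSet_Ico, ← Finset.sum_mul, mul_comm]
        simp [Real.volume_Ico]
    _ ≤ _ := mul_le_mul_right (measure_mono hsub) _

/-- Letting `r → 0` gives `μ ≤ h ν` on closed subsets of `E i`, and inner regularity extends it to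
Borel sets. Both sides have total mass `h`, so they agree; that cylinders overlap in null sets need
not be known beforehand. -/
theorem omegaHausdorff_eq_mul_volume_preimage [Finite V] (hd : 0 < d) (hδ : δ < 1)
    (hφ : IsKernel δ φ) (hE : G.IsInvariantFamily E) (hp : G.IsSplitting p)
    (hD : G.IsDigitMap p D)
    (hψ : ∀ x ∈ Icc (0 : ℝ) 1, ∀ k, ψ x ∈ G.cylinder E i (G.address p D i k x))
    (hcont : Continuous ψ) {s : ℝ}
    (hcyl : ∀ k, ∀ γ ∈ G.walks i k, omegaHausdorff G.A φ s (G.cylinder E i γ) ≤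
      ENNReal.ofReal (weight p γ) * omegaHausdorff G.A φ s (E i))
    (hfin : omegaHausdorff G.A φ s (E i) ≠ ⊤) {B : Set 𝔼} (hB : MeasurableSet B) (hBE : B ⊆ E i) :
    omegaHausdorff G.A φ s B =
      omegaHausdorff G.A φ s (E i) * volume (ψ ⁻¹' B ∩ Icc 0 1) := by
  obtain ⟨μ, hμ⟩ := exists_measure_eq_omegaHausdorff hd G.expanding hδ hφ s
  set h := omegaHausdorff G.A φ s (E i) with hh
  set ν : Measure 𝔼 := (volume.restrict (Icc (0 : ℝ) 1)).map ψ with hν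
  have hνapp : ∀ T, MeasurableSet T → ν T = volume (ψ ⁻¹' T ∩ Icc 0 1) := fun T hT => by
    rw [hν, Measure.map_apply hcont.measurable hT,
      Measure.restrict_apply (hcont.measurable hT)]
  have hEm : MeasurableSet (E i) := (hE.isCompact i).isClosed.measurableSet
  have hνuniv : ν univ = 1 := by
    rw [hνapp _ MeasurableSet.univ]
    simp
  have : IsFiniteMeasure ν := ⟨by rw [hνuniv]; exact ENNReal.one_lt_top⟩
  have hμE : IsFiniteMeasure (μ.restrict (E i)) := ⟨by
    rw [Measure.restrict_apply_univ, hμ _ hEm]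
    exact hfin.lt_top⟩
  have hclosed : ∀ K, IsClosed K → K ⊆ E i → μ K ≤ h * ν K := by
    intro K hK hKE
    rw [hμ K hK.measurableSet]
    have hlim := tendsto_measure_cthickening_of_isClosed (μ := ν)
      ⟨1, one_pos, measure_ne_top _ _⟩ hK
    have hlim' := ENNReal.Tendsto.const_mul (hlim.mono_left
      (nhdsWithin_le_nhds (s := Ioi 0))) (Or.inr hfin)
    refine ge_of_tendsto hlim' ?_
    filter_upwards [self_mem_nhdsWithin] with r hr
    rw [hνapp _ Metric.isClosed_cthickening.measurableSet]
    exact omegaHausdorff_le_mul_volume_cthickening hd hδ hφ hE hp hD hψ hcyl hKE hr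
  have hle : μ.restrict (E i) ≤ h • ν := by
    refine Measure.le_iff.2 fun T hT => ?_
    rw [hT.measure_eq_iSup_isClosed_of_ne_top (measure_ne_top _ _)]
    refine iSup₂_le fun K hKT => iSup_le fun hK => ?_
    rw [Measure.restrict_apply hK.measurableSet, Measure.smul_apply, smul_eq_mul]
    exact (hclosed _ (hK.inter (hE.isCompact i).isClosed) inter_subset_right).trans
      (mul_le_mul_right (measure_mono (inter_subset_left.trans hKT)) _)
  have heq : μ.restrict (E i) = h • ν := by
    refine Measure.eq_of_le_of_measure_univ_eq hle ?_
    rw [Measure.restrict_apply_univ, hμ _ hEm, Measure.smul_apply, hνuniv, smul_eq_mul, mul_one]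
  have := congrArg (fun m : Measure 𝔼 => m B) heq
  simp only [Measure.smul_apply, smul_eq_mul] at this
  rwa [Measure.restrict_apply hB, inter_eq_left.2 hBE, hμ B hB, hνapp B hB] at this

/-- The preimage of a cylinder contains its interval and has no larger measure, so the excess is
null. Off the countable union `N` of these excesses, points with equal image lie in common intervals
of every level, whose lengths tend to zero. -/
theorem exists_injOn_coding (hE : G.IsInvariantFamily E) (hp : G.IsSplitting p)
    (hD : G.IsDigitMap p D)
    (hψ : ∀ x ∈ Icc (0 : ℝ) 1, ∀ k, ψ x ∈ G.cylinder E i (G.address p D i k x))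
    (hcont : Continuous ψ)
    (hvol : ∀ k, ∀ γ ∈ G.walks i k, volume (ψ ⁻¹' G.cylinder E i γ ∩ Icc 0 1) ≤
      ENNReal.ofReal (weight p γ)) {ρ c : ℝ} (hρ : 0 < ρ) (hρ1 : ρ < 1)
    (hw : ∀ k, ∀ γ ∈ G.walks i k, weight p γ ≤ c * ρ ^ k) :
    ∃ I ⊆ Icc (0 : ℝ) 1, MeasurableSet I ∧ volume (Icc 0 1 \ I) = 0 ∧ InjOn ψ I := by
  set N : Set ℝ := ⋃ (k : ℕ), ⋃ γ ∈ G.walks i k, (ψ ⁻¹' G.cylinder E i γ ∩ Icc 0 1) \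
    Ico (G.walkLeft p γ) (G.walkLeft p γ + weight p γ) with hN
  have hPm : ∀ γ : List Γ, MeasurableSet (ψ ⁻¹' G.cylinder E i γ ∩ Icc (0 : ℝ) 1) := fun γ =>
    (hcont.measurable (hE.isCompact_cylinder i γ).isClosed.measurableSet).inter measurableSet_Icc
  have hNm : MeasurableSet N := MeasurableSet.iUnion fun k =>
    (G.finite_walks i k).measurableSet_biUnion fun γ _ => (hPm γ).diff measurableSet_Ico
  have hN0 : volume N = 0 := by
    refine measure_iUnion_null fun k =>
      (measure_biUnion_null_iff (G.finite_walks i k).countable).2 fun γ hγ => ?_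
    have hsub := hp.Ico_subset_preimage_cylinder hD hψ hγ
    rw [measure_sdiff hsub measurableSet_Ico.nullMeasurableSet (by simp), Real.volume_Ico,
      add_sub_cancel_left]
    exact tsub_eq_zero_of_le (hvol k γ hγ)
  refine ⟨Icc 0 1 \ N, sdiff_subset, measurableSet_Icc.diff hNm,
    measure_mono_null (fun x hx => ?_) hN0, ?_⟩
  · by_contra hxN
    exact hx.2 ⟨hx.1, hxN⟩
  · intro x hx y hy hxy
    have hmem : ∀ z ∈ Icc 0 1 \ N, ψ z = ψ x → ∀ k,
        z ∈ Icc (G.walkLeft p (G.address p D i k x))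
          (G.walkLeft p (G.address p D i k x) + weight p (G.address p D i k x)) := by
      intro z hz hzx k
      apply Ico_subset_Icc_self
      by_contra hcon
      refine hz.2 (mem_iUnion.2 ⟨k, mem_iUnion₂.2 ⟨_, hp.address_mem_walks hD i k hx.1, ?_⟩⟩)
      refine ⟨⟨?_, hz.1⟩, hcon⟩
      rw [mem_preimage, hzx]
      exact hψ x hx.1 k
    have hdist : ∀ k : ℕ, |x - y| ≤ c * ρ ^ k := by
      intro k
      have h1 := hmem x hx rfl k
      have h2 := hmem y hy hxy.symm k
      have h3 := hw k _ (hp.address_mem_walks hD i k hx.1)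
      rw [abs_le]
      constructor <;> linarith [h1.1, h1.2, h2.1, h2.2]
    have hlim : Filter.Tendsto (fun k : ℕ => c * ρ ^ k) Filter.atTop (nhds 0) := by
      simpa using (tendsto_pow_atTop_nhds_zero_of_lt_one hρ.le hρ1).const_mul c
    have := ge_of_tendsto' hlim hdist
    exact sub_eq_zero.1 (abs_nonpos_iff.1 this)

/-- On the full-measure set `I` of injectivity, images of Borel sets are Borel and preimages recover
the set up to null sets. The image of `F` itself need not be Borel, but it differs from that of `F ∩
I` only within the image of a null set. -/
theorem isMeasureIso_coding [Finite V] (hd : 0 < d) (hδ : δ < 1)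
    (hφ : IsKernel δ φ) (hE : G.IsInvariantFamily E) (hp : G.IsSplitting p)
    (hD : G.IsDigitMap p D)
    (hψ : ∀ x ∈ Icc (0 : ℝ) 1, ∀ k, ψ x ∈ G.cylinder E i (G.address p D i k x))
    (hcont : Continuous ψ) (himage : ψ '' Icc 0 1 = E i) {s : ℝ}
    (hcyl : ∀ k, ∀ γ ∈ G.walks i k, omegaHausdorff G.A φ s (G.cylinder E i γ) ≤
      ENNReal.ofReal (weight p γ) * omegaHausdorff G.A φ s (E i))
    (hpos : omegaHausdorff G.A φ s (E i) ≠ 0) (hfin : omegaHausdorff G.A φ s (E i) ≠ ⊤)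
    (hnull : ∀ F ⊆ Icc (0 : ℝ) 1, volume F = 0 → omegaHausdorff G.A φ s (ψ '' F) = 0)
    {ρ c : ℝ} (hρ : 0 < ρ) (hρ1 : ρ < 1)
    (hw : ∀ k, ∀ γ ∈ G.walks i k, weight p γ ≤ c * ρ ^ k) :
    IsMeasureIso (omegaHausdorff G.A φ s) ψ (E i) := by
  set h := omegaHausdorff G.A φ s (E i) with hh
  have hpre : ∀ B : Set 𝔼, B ⊆ E i → MeasurableSet B →
      volume (ψ ⁻¹' B ∩ Icc 0 1) = h⁻¹ * omegaHausdorff G.A φ s B := by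
    intro B hBE hB
    rw [omegaHausdorff_eq_mul_volume_preimage hd hδ hφ hE hp hD hψ hcont hcyl hfin hB hBE,
      ← mul_assoc, ENNReal.inv_mul_cancel hpos hfin, one_mul]
  have hvol : ∀ k, ∀ γ ∈ G.walks i k, volume (ψ ⁻¹' G.cylinder E i γ ∩ Icc 0 1) ≤
      ENNReal.ofReal (weight p γ) := by
    intro k γ hγ
    rw [hpre _ (hE.cylinder_subset hγ.1) (hE.isCompact_cylinder i γ).isClosed.measurableSet]
    calc h⁻¹ * omegaHausdorff G.A φ s (G.cylinder E i γ)
        ≤ h⁻¹ * (ENNReal.ofReal (weight p γ) * h) := mul_le_mul_right (hcyl k γ hγ) _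
      _ = ENNReal.ofReal (weight p γ) := by
        rw [mul_comm _ h, ← mul_assoc, ENNReal.inv_mul_cancel hpos hfin, one_mul]
  obtain ⟨I, hI, hIm, hI0, hinj⟩ := exists_injOn_coding hE hp hD hψ hcont hvol hρ hρ1 hw
  have hIE : ∀ F ⊆ Icc (0 : ℝ) 1, ψ '' F ⊆ E i := fun F hF => himage ▸ image_mono hF
  have hImg : ∀ F : Set ℝ, MeasurableSet F → MeasurableSet (ψ '' (F ∩ I)) := fun F hF =>
    (hF.inter hIm).image_of_continuousOn_injOn hcont.continuousOn (hinj.mono inter_subset_right)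
  have hvolimg : ∀ F : Set ℝ, F ⊆ Icc 0 1 → MeasurableSet F →
      omegaHausdorff G.A φ s (ψ '' (F ∩ I)) = h * volume F := by
    intro F hF hFm
    rw [omegaHausdorff_eq_mul_volume_preimage hd hδ hφ hE hp hD hψ hcont hcyl hfin (hImg F hFm)
      (hIE _ (inter_subset_right.trans hI)), ← hh]
    congr 1
    apply le_antisymm
    · have hsub : ψ ⁻¹' (ψ '' (F ∩ I)) ∩ Icc 0 1 ⊆ F ∪ (Icc 0 1 \ I) := by
        rintro x ⟨⟨y, ⟨hyF, hyI⟩, hyx⟩, hx⟩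
        by_cases hxI : x ∈ I
        · left
          rwa [← hinj hyI hxI hyx]
        · exact Or.inr ⟨hx, hxI⟩
      refine (measure_mono hsub).trans ((measure_union_le _ _).trans ?_)
      rw [hI0, add_zero]
    · have hsub : F ⊆ (ψ ⁻¹' (ψ '' (F ∩ I)) ∩ Icc 0 1) ∪ (Icc 0 1 \ I) := by
        intro x hx
        by_cases hxI : x ∈ I
        · exact Or.inl ⟨mem_image_of_mem ψ ⟨hx, hxI⟩, hF hx⟩
        · exact Or.inr ⟨hF hx, hxI⟩
      refine (measure_mono hsub).trans ((measure_union_le _ _).trans ?_)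
      rw [hI0, add_zero]
  refine ⟨pos_iff_ne_zero.2 hpos, hfin.lt_top, ?_, fun F hF hFm => ?_, fun B hBE hB => ?_⟩
  · have hSm : MeasurableSet (ψ '' I) := by
      simpa using hImg univ MeasurableSet.univ
    refine ⟨I, ψ '' I, hI, hIE I hI, hIm, hSm, hI0, ?_, hinj.bijOn_image⟩
    refine le_antisymm ?_ zero_le
    rw [← hnull (Icc 0 1 \ I) sdiff_subset hI0]
    refine omegaHausdorff_mono s ?_
    rintro z ⟨hz, hzI⟩
    rw [← himage] at hz
    obtain ⟨x, hx, rfl⟩ := hz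
    exact mem_image_of_mem ψ ⟨hx, fun hxI => hzI (mem_image_of_mem ψ hxI)⟩
  · apply le_antisymm
    · have hsub : ψ '' F ⊆ ψ '' (F ∩ I) ∪ ψ '' (Icc 0 1 \ I) := by
        rw [← image_union]
        refine image_mono fun x hx => ?_
        by_cases hxI : x ∈ I
        · exact Or.inl ⟨hx, hxI⟩
        · exact Or.inr ⟨hF hx, hxI⟩
      refine (omegaHausdorff_mono s hsub).trans ((omegaHausdorff_union_le s _ _).trans ?_)
      rw [hnull _ sdiff_subset hI0, add_zero, hvolimg F hF hFm]
    · rw [← hvolimg F hF hFm]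
      exact omegaHausdorff_mono s (image_mono inter_subset_left)
  · rw [inter_comm, hpre B hBE hB]

end Coding

open Classical in
/-- The Hausdorff measures of the invariant sets form a Perron eigenvector, so that the measure
of a cylinder is at most its weight times the total mass. -/
theorem omegaHausdorff_cylinder_le [Fintype Γ] (hE : G.IsInvariantFamily E) {ρ s : ℝ} {v : V → ℝ}
    (hd : 0 < d) (hρ : 0 < ρ) (hv : ∀ i, 0 < v i) (hs : 0 < s) (hκ : ratio G.A ^ s = ρ)
    (hrigid : ∀ h : V → ℝ, (∀ i, h i ≤ ∑ e with G.src e = i, ρ * h (G.tgt e)) →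
        ∃ c : ℝ, ∀ i, h i = c * v i)
    (hfin : ∀ i, omegaHausdorff G.A φ s (E i) ≠ ⊤) {i : V} {k : ℕ} {γ : List Γ}
    (hγ : γ ∈ G.walks i k) :
    omegaHausdorff G.A φ s (G.cylinder E i γ) ≤
      ENNReal.ofReal (weight (G.edgeWeight ρ v) γ) * omegaHausdorff G.A φ s (E i) := by
  have hκ0 := ratio_pos G.expanding
  have hκ1 := ratio_lt_one hd G.expanding
  have hwalk : ∀ (γ : List Γ) (S : Set 𝔼), omegaHausdorff G.A φ s (G.walkMap γ '' S) ≤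
      ENNReal.ofReal (ρ ^ γ.length) * omegaHausdorff G.A φ s S := by
    intro γ S
    have := omegaHausdorff_image_le (A := G.A) (φ := φ) (pow_pos hκ0 γ.length)
      (pow_le_one₀ hκ0.le hκ1.le) hs.le (fun x y => pseudoNorm_walkMap_sub γ x y) S
    rwa [ENNReal.ofReal_rpow_of_pos (pow_pos hκ0 _), ← Real.rpow_natCast, ← Real.rpow_mul hκ0.le,
      mul_comm _ s, Real.rpow_mul hκ0.le, hκ, Real.rpow_natCast] at this
  set h : V → ℝ := fun i => (omegaHausdorff G.A φ s (E i)).toReal with hh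
  have hof : ∀ i, omegaHausdorff G.A φ s (E i) = ENNReal.ofReal (h i) := fun i =>
    (ENNReal.ofReal_toReal (hfin i)).symm
  have hh0 : ∀ i, 0 ≤ h i := fun i => ENNReal.toReal_nonneg
  -- Subadditivity and scaling give only the inequality `h i ≤ ∑ ρ h (tgt e)`; rigidity upgrades it
  -- to `h = c v`.
  obtain ⟨c, hc⟩ := hrigid h fun i => by
    rw [← ENNReal.ofReal_le_ofReal_iff (Finset.sum_nonneg fun e _ => mul_nonneg hρ.le (hh0 _)),
      ← hof, ENNReal.ofReal_sum_of_nonneg fun e _ => mul_nonneg hρ.le (hh0 _)]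
    have hcov : E i ⊆ ⋃ e ∈ Finset.univ.filter fun e => G.src e = i, G.map e '' E (G.tgt e) := by
      conv_lhs => rw [hE.eq_iUnion i]
      simp
    refine (omegaHausdorff_mono s hcov).trans ((omegaHausdorff_biUnion_finset_le s _ _).trans
      (Finset.sum_le_sum fun e _ => ?_))
    rw [ENNReal.ofReal_mul hρ.le, ← hof]
    simpa [walkMap] using hwalk [e] (E (G.tgt e))
  refine (hwalk γ _).trans_eq ?_
  rw [hof, hof, hγ.2, ← ENNReal.ofReal_mul (pow_pos hρ k).le, ← ENNReal.ofReal_mul', hc, hc]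
  · congr 1
    rw [mul_left_comm, ← weight_edgeWeight hv hγ]
    ring
  · exact hh0 i

end OrderedGIFS

end LinearGIFS

/-! ### Assembly. -/

theorem theorem1p1 {d : ℕ} (hd : 0 < d)
    {V Γ : Type*} [Fintype V] [DecidableEq V] [Fintype Γ]
    (hΓ : 1 < Fintype.card Γ)
    (G : LinearGIFS.OrderedGIFS d V Γ)
    (E : V → Set (EuclideanSpace ℝ (Fin d)))
    (hE : G.IsInvariantFamily E)
    (hlin : G.IsLinear E)
    (hosc : G.OpenSetCondition)
    (hprim : G.assocMatrix.IsPrimitive)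
    (δ : ℝ) (hδ : δ ∈ Set.Ioo (0 : ℝ) (1 / 2))
    (φ : EuclideanSpace ℝ (Fin d) → ℝ) (hφ : LinearGIFS.IsKernel δ φ)
    (j : V) (α : ℝ) (hα : α = LinearGIFS.omegaDim G.A φ (E j)) :
    0 < α ∧
    ∃ ψ : ℝ → EuclideanSpace ℝ (Fin d),
      LinearGIFS.IsParametrization ψ (E j) ∧
      LinearGIFS.IsMeasureIso (LinearGIFS.omegaHausdorff G.A φ α) ψ (E j) ∧
      ∃ c : ℝ, 0 < c ∧ ∀ x ∈ Set.Icc (0 : ℝ) 1, ∀ y ∈ Set.Icc (0 : ℝ) 1,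
        LinearGIFS.pseudoNorm G.A φ (ψ x - ψ y) ≤ c * |x - y| ^ (1 / α) := by
  classical
  have : Nonempty V := ⟨j⟩
  have hδ1 : δ < 1 := hδ.2.trans (by norm_num)
  obtain ⟨ρ, hρ, hρ1, v, hv, hsum, hrigid⟩ := G.exists_perron_data hΓ hprim
  have hκ0 := LinearGIFS.ratio_pos G.expanding
  have hκ1 := LinearGIFS.ratio_lt_one hd G.expanding
  have hs : 0 < Real.logb (LinearGIFS.ratio G.A) ρ :=
    Real.logb_pos_of_base_lt_one hκ0 hκ1 hρ hρ1
  have hκ : LinearGIFS.ratio G.A ^ Real.logb (LinearGIFS.ratio G.A) ρ = ρ :=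
    Real.rpow_logb hκ0 hκ1.ne hρ
  set s := Real.logb (LinearGIFS.ratio G.A) ρ
  have hp := LinearGIFS.OrderedGIFS.isSplitting_edgeWeight (G := G) hρ hv
    fun i => by convert hsum i
  obtain ⟨D, hD⟩ := hp.exists_isDigitMap
  obtain ⟨c₁, c₂, hc₁, hc₂, hw⟩ := LinearGIFS.OrderedGIFS.exists_weight_bounds (G := G) hρ hv
  -- The coding is extended constantly beyond `[0,1]`, to be continuous, hence measurable, on the
  -- whole line.
  have hcoding : ∀ i, ∃ ψ : ℝ → EuclideanSpace ℝ (Fin d), Continuous ψ ∧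
      (∀ x ∈ Set.Icc (0 : ℝ) 1, ∀ k, ψ x ∈
        G.cylinder E i (G.address (G.edgeWeight ρ v) D i k x)) ∧
      ∃ c : ℝ, 0 < c ∧ ∀ x ∈ Set.Icc (0 : ℝ) 1, ∀ y ∈ Set.Icc (0 : ℝ) 1,
        LinearGIFS.pseudoNorm G.A φ (ψ x - ψ y) ≤ c * |x - y| ^ (1 / s) := by
    intro i
    obtain ⟨ψ, hψ⟩ := hE.exists_coding hp hD i
    obtain ⟨c, hc, hhol⟩ := LinearGIFS.OrderedGIFS.exists_holder_bound hd hδ1 hφ hE hlin hp hD hρ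
      hρ1 hs hκ hc₁ (fun k γ hγ => (hw i k γ hγ).1) hψ
    have hcont := LinearGIFS.OrderedGIFS.continuousOn_of_pseudoNorm_holder G.expanding hd hδ1 hφ
      hc (one_div_pos.2 hs) hhol
    have heq : ∀ x ∈ Set.Icc (0 : ℝ) 1,
        Set.IccExtend zero_le_one ((Set.Icc (0 : ℝ) 1).domRestrict ψ) x = ψ x := fun x hx =>
      Set.IccExtend_of_mem _ _ hx
    refine ⟨Set.IccExtend zero_le_one ((Set.Icc (0 : ℝ) 1).domRestrict ψ),
      (continuousOn_iff_continuous_domRestrict.1 hcont).Icc_extend', fun x hx k => ?_, c, hc,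
      fun x hx y hy => ?_⟩
    · rw [heq x hx]
      exact hψ x hx k
    · rw [heq x hx, heq y hy]
      exact hhol x hx y hy
  have himage : ∀ i (ψ : ℝ → EuclideanSpace ℝ (Fin d)), Continuous ψ →
      (∀ x ∈ Set.Icc (0 : ℝ) 1, ∀ k, ψ x ∈
        G.cylinder E i (G.address (G.edgeWeight ρ v) D i k x)) → ψ '' Set.Icc 0 1 = E i :=
    fun i ψ hcont hψ =>
      LinearGIFS.OrderedGIFS.image_coding_eq hd hδ1 hφ hE hp hD hψ hcont.continuousOn
  -- Finiteness is needed at every vertex, since the rigidity argument compares all the `E i`.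
  have hfin : ∀ i, LinearGIFS.omegaHausdorff G.A φ s (E i) ≠ ⊤ := by
    intro i
    obtain ⟨ψ, hcont, hψ, c, hc, hhol⟩ := hcoding i
    rw [← himage i ψ hcont hψ]
    refine ((LinearGIFS.omegaHausdorff_image_le_of_holder hc hs hhol).trans_lt
      (ENNReal.mul_lt_top ?_ ?_)).ne
    · exact ENNReal.rpow_lt_top_of_nonneg hs.le ENNReal.ofReal_ne_top
    · simp
  obtain ⟨ψ, hcont, hψ, c, hc, hhol⟩ := hcoding j
  have hψE := himage j ψ hcont hψ
  have hpos : LinearGIFS.omegaHausdorff G.A φ s (E j) ≠ 0 := by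
    obtain ⟨C, hC, hvol⟩ := LinearGIFS.OrderedGIFS.exists_volume_preimage_le hd hδ1 hφ hE hosc hp
      hD hρ hρ1 hs hκ hc₂ (fun k γ hγ => (hw j k γ hγ).2) hψ
    -- The mass is the image under `ψ` of Lebesgue outer measure on `[0,1]`; it gives `E j` mass
    -- one.
    have h := LinearGIFS.outerMeasure_le_mul_omegaHausdorff
      (ν := MeasureTheory.OuterMeasure.map ψ (MeasureTheory.OuterMeasure.restrict (Set.Icc 0 1)
        (MeasureTheory.volume : MeasureTheory.Measure ℝ).toOuterMeasure))
      (ENNReal.ofReal_pos.2 hC).ne' ENNReal.ofReal_ne_top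
      (fun T hT => by
        rw [MeasureTheory.OuterMeasure.map_apply, MeasureTheory.OuterMeasure.restrict_apply]
        exact hvol T hT) (E j)
    intro h0
    have h1 : Set.Icc (0 : ℝ) 1 ⊆ ψ ⁻¹' E j := fun x hx => hψE ▸ Set.mem_image_of_mem ψ hx
    rw [h0, mul_zero, MeasureTheory.OuterMeasure.map_apply,
      MeasureTheory.OuterMeasure.restrict_apply, Set.inter_eq_right.2 h1] at h
    simp at h
  have hdim : α = s := hα.trans (LinearGIFS.omegaDim_eq hs.le hpos (hfin j))
  rw [hdim]
  refine ⟨hs, ψ, ⟨hcont.continuousOn, hψE⟩, ?_, c, hc, hhol⟩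
  refine LinearGIFS.OrderedGIFS.isMeasureIso_coding hd hδ1 hφ hE hp hD hψ hcont hψE
    (fun k γ hγ => LinearGIFS.OrderedGIFS.omegaHausdorff_cylinder_le hE hd hρ hv hs hκ
      (fun h hh => hrigid h fun i => by convert hh i) hfin hγ) hpos (hfin j) (fun F hF hF0 => ?_) hρ hρ1 (fun k γ hγ => (hw j k γ hγ).2)
  have := LinearGIFS.omegaHausdorff_image_le_of_holder hc hs
    fun x hx y hy => hhol x (hF hx) y (hF hy)
  rw [hF0, mul_zero] at this
  exact le_antisymm this zero_le
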